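/- Fix an integer $d\ge 2$ and a sequence of positive integers $k=k_p$ with $k=o(p)$ as $p\to\infty$. Let $\tilde{\mathrm P}_p$ be one of the following two priors on the unit sphere of $\mathbb R^p$ (for $p$ large enough that $k_p\le p$): - Bernoulli: the uniform distribution on the set of vectors in $\{0,1/\sqrt k\}^p$ with exactly $k$ nonzero entries; - Bernoulli-Rademacher: the uniform distribution on the set of vectors in $\{-1/\sqrt k,0,1/\sqrt k\}^p$ with exactly $k$ nonzero entries. For $\mathbf x\in\mathbb R^p$ let $\mathbf x^{\otimes d}\in\mathbb R^{p^d}$ be the vector whose entry indexed by $(i_1,\dots,i_d)\in[p]^d$ is $\mathbf x_{i_1}\cdots \mathbf x_{i_d}$. For $\beta\ge 0$ consider the sparse tensor PCA model $$\mathbf Y=\beta\sqrt{2k\log\left(\frac pk\right)}\;\mathbf x^{\otimes d}+\mathbf Z,\qquad \mathbf x\sim\tilde{\mathrm P}_p,$$ where $\mathbf Z\in\mathbb R^{p^d}$ has i.i.d. standard Gaussian entries and is independent of $\mathbf x$. Then, for either prior and for every fixed $\beta\ge 0$ with $\beta\ne 1$, the minimum mean squared error satisfies $$\lim_{p\to\infty}\mathbb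 E\,\bigl\|\mathbf x^{\otimes d}-\mathbb E[\mathbf x^{\otimes d}\mid\mathbf Y]\bigr\|^2=\begin{cases}1&\text{if }\beta<1,\\ 0&\text{if }\beta>1.\end{cases}$$ -/

import Mathlib

open MeasureTheory ProbabilityTheory Filter Topology Asymptotics

noncomputable section

/-- The `k`-sparse vectors of `ℝ^p` with entries in `{0, 1/√k}`: exactly `k` nonzero entries. -/
def bernoulliSupport (p k : ℕ) : Set (EuclideanSpace ℝ (Fin p)) :=
  {x | (∀ i, x i = 0 ∨ x i = 1 / √(k : ℝ)) ∧ {i | x i ≠ 0}.ncard = k}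

/-- The `k`-sparse vectors of `ℝ^p` with entries in `{-1/√k, 0, 1/√k}`: exactly `k` nonzero
entries. -/
def bernoulliRademacherSupport (p k : ℕ) : Set (EuclideanSpace ℝ (Fin p)) :=
  {x | (∀ i, x i = -(1 / √(k : ℝ)) ∨ x i = 0 ∨ x i = 1 / √(k : ℝ)) ∧ {i | x i ≠ 0}.ncard = k}

/-- The Bernoulli prior on `ℝ^p`. -/
def bernoulliPrior (p k : ℕ) : Measure (EuclideanSpace ℝ (Fin p)) :=
  uniformOn (bernoulliSupport p k)

/-- The Bernoulli-Rademacher prior on `ℝ^p`. -/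
def bernoulliRademacherPrior (p k : ℕ) : Measure (EuclideanSpace ℝ (Fin p)) :=
  uniformOn (bernoulliRademacherSupport p k)

/-- The tensor power `x^{⊗d}`, as the vector of `ℝ^(p^d)` whose entry at `(i₁, …, i_d)` is
`x_{i₁} ⋯ x_{i_d}`. -/
def tensorPow {p : ℕ} (d : ℕ) (x : EuclideanSpace ℝ (Fin p)) :
    EuclideanSpace ℝ (Fin d → Fin p) :=
  WithLp.toLp 2 fun i => ∏ j, x (i j)

/-- The probability space of the tensor PCA model: pairs `(x, Z)` of independent variables, with
`x` drawn from `P` and `Z` a vector of i.i.d. standard Gaussian entries indexed by `[p]^d`. -/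
def tensorModel {p : ℕ} (d : ℕ) (P : Measure (EuclideanSpace ℝ (Fin p))) :
    Measure (EuclideanSpace ℝ (Fin p) × EuclideanSpace ℝ (Fin d → Fin p)) :=
  P.prod (stdGaussian (EuclideanSpace ℝ (Fin d → Fin p)))

/-- The observation `Y = a x^{⊗d} + Z`. -/
def tensorObservation {p : ℕ} (d : ℕ) (a : ℝ)
    (ω : EuclideanSpace ℝ (Fin p) × EuclideanSpace ℝ (Fin d → Fin p)) :
    EuclideanSpace ℝ (Fin d → Fin p) :=
  a • tensorPow d ω.1 + ω.2

/-- The minimum mean squared error `E ‖x^{⊗d} - E[x^{⊗d} | Y]‖²` in the model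
`Y = a x^{⊗d} + Z`, `x ∼ P`. -/
def tensorMMSE {p : ℕ} (d : ℕ) (a : ℝ) (P : Measure (EuclideanSpace ℝ (Fin p))) : ℝ :=
  ∫ ω, ‖tensorPow d ω.1 -
    ((tensorModel d P)[fun ω' => tensorPow d ω'.1 |
      MeasurableSpace.comap (tensorObservation d a) inferInstance]) ω‖ ^ 2 ∂(tensorModel d P)

/-- The amplitude `β √(2 k log(p/k))` of the signal. -/
def sparseAmplitude (p k : ℕ) (β : ℝ) : ℝ :=
  β * √(2 * (k : ℝ) * Real.log ((p : ℝ) / (k : ℝ)))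

end

/-! Let `e_x` be the density of `a x^{⊗d} + Z` with respect to the noise law, `T = ∑ e_x` over the
`M` possible signals, and `h = k log(p/k)`, so that `a² = 2β²h`. By Bayes and Cameron-Martin, the
error is `M⁻¹ E ∑ (1 - ρ) e_x e_{x'} / T` with `y` pure noise, where `ρ = ⟪x, x'⟫^d` and `E T = M`.
The question is which pairs carry the weight `e_x e_{x'} / T`: those with `ρ ≈ 0` (error `1`) or
those with `ρ ≈ 1` (error `0`). In both regimes the event that `⟪x^{⊗d}, y⟫` is off from its planted
mean `a` by more than `τ` is discarded at Gaussian-tail cost.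

For `β < 1`, pairs with `ρ ≥ ε` are negligible by a second moment bound. The plain second moment
`exp(a²ρ)` is too large when `β² > 1/2`; truncating at `⟪·, y⟫ ≤ a + τ` lowers it to about
`exp(a²ρ/(1+ρ))` (`one_sub_posteriorError_le`). For `β > 1`, pairs with `ρ ≤ 1 - ε` are negligible:
`T ≥ √(e_x e_{x'})` bounds the weight by `√(e_x e_{x'})`, whose truncated mean is about
`exp(-(a²/2)(1-r)/(1+r))` with `r = max ρ 0` (`posteriorError_le`).

Let `q` be the fraction of shared support. Then `|⟪x, x'⟫| ≤ q`, and `d ≥ 2` gives `ρ ≤ q²`, hence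
`2ρ/(1+ρ) ≤ q`. Both estimates thus reduce to the average of `exp(hq) = (p/k)^{|A ∩ B|}`, which is
at most `2^k`. Since `k = o(p)`, `k = o(h)`; also `M ≤ exp(h + 2k)`. The gap between `β²` and `1`
leaves a factor `exp(-cεh)` up to constants, which beats every `exp(O(k))`. Signs only cost a factor
`2^k`, so both priors have the same threshold. -/

/-! ### Exponential integrals and the Cameron-Martin formula -/

section Gaussian

open scoped RealInnerProductSpace

variable {F : Type*} [NormedAddCommGroup F] [InnerProductSpace ℝ F] [FiniteDimensional ℝ F]
  [MeasurableSpace F] [BorelSpace F]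

/-- Taking a real and an imaginary direction together yields both the exponential moments and the
characteristic function of the tilted measure. In an orthonormal basis the integral factors into
one-dimensional ones. -/
theorem integral_cexp_inner_stdGaussian (v t : F) :
    ∫ y, Complex.exp (⟪y, v⟫ + ⟪y, t⟫ * Complex.I) ∂(stdGaussian F) =
      Complex.exp ((‖v‖ ^ 2 - ‖t‖ ^ 2) / 2 + ⟪v, t⟫ * Complex.I) := by
  set b := stdOrthonormalBasis ℝ F
  have hcoord (x : Fin (Module.finrank ℝ F) → ℝ) :
      Complex.exp (⟪∑ i, x i • b i, v⟫ + ⟪∑ i, x i • b i, t⟫ * Complex.I) =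
        ∏ i, Complex.exp ((⟪b i, v⟫ + ⟪b i, t⟫ * Complex.I) * x i) := by
    rw [← Complex.exp_sum]
    simp only [sum_inner, real_inner_smul_left, Complex.ofReal_sum, Complex.ofReal_mul,
      Finset.sum_mul]
    rw [← Finset.sum_add_distrib]
    exact congrArg _ (Finset.sum_congr rfl fun i _ => by ring)
  have hone (z : ℂ) : ∫ x : ℝ, Complex.exp (z * x) ∂(gaussianReal 0 1) =
      Complex.exp (z ^ 2 / 2) := by
    simpa [complexMGF] using complexMGF_id_gaussianReal (μ := 0) (v := 1) z
  rw [stdGaussian, integral_map (Measurable.aemeasurable (by fun_prop))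
    (Measurable.aestronglyMeasurable (by fun_prop))]
  rw [integral_congr_ae (ae_of_all _ hcoord)]
  rw [integral_fintype_prod_eq_prod
    (f := fun i (x : ℝ) => Complex.exp ((⟪b i, v⟫ + ⟪b i, t⟫ * Complex.I) * x))]
  simp_rw [hone]
  rw [← Complex.exp_sum]
  congr 1
  have h1 : ((‖v‖ ^ 2 : ℝ) : ℂ) = ∑ i, (⟪b i, v⟫ : ℂ) ^ 2 := by
    rw [← b.sum_sq_inner_right v]; push_cast; rfl
  have h2 : ((‖t‖ ^ 2 : ℝ) : ℂ) = ∑ i, (⟪b i, t⟫ : ℂ) ^ 2 := by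
    rw [← b.sum_sq_inner_right t]; push_cast; rfl
  have h3 : ((⟪v, t⟫ : ℝ) : ℂ) = ∑ i, (⟪b i, v⟫ : ℂ) * ⟪b i, t⟫ := by
    rw [← b.sum_inner_mul_inner v t]; push_cast
    exact Finset.sum_congr rfl fun i _ => by rw [real_inner_comm]
  push_cast at h1 h2
  rw [h1, h2, h3, ← Finset.sum_sub_distrib, Finset.sum_div, Finset.sum_mul,
    ← Finset.sum_add_distrib]
  refine Finset.sum_congr rfl fun i _ => ?_
  linear_combination ((⟪b i, t⟫ : ℂ) ^ 2 / 2) * Complex.I_sq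

theorem integral_exp_inner_stdGaussian (v : F) :
    ∫ y, Real.exp ⟪v, y⟫ ∂(stdGaussian F) = Real.exp (‖v‖ ^ 2 / 2) := by
  have h := integral_cexp_inner_stdGaussian v 0
  have h' : ∫ y, ((Real.exp ⟪v, y⟫ : ℝ) : ℂ) ∂(stdGaussian F) =
      ((Real.exp (‖v‖ ^ 2 / 2) : ℝ) : ℂ) := by
    simpa [real_inner_comm] using h
  rw [integral_complex_ofReal] at h'
  exact_mod_cast h'

theorem integrable_exp_inner_stdGaussian (v : F) :
    Integrable (fun y => Real.exp ⟪v, y⟫) (stdGaussian F) := by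
  by_contra h
  have := integral_exp_inner_stdGaussian v
  rw [integral_undef h] at this
  exact (Real.exp_pos _).ne this

theorem integral_exp_inner_add_const_stdGaussian (v : F) (c : ℝ) :
    ∫ y, Real.exp (⟪v, y⟫ + c) ∂(stdGaussian F) = Real.exp (‖v‖ ^ 2 / 2 + c) := by
  simp_rw [Real.exp_add, integral_mul_const, integral_exp_inner_stdGaussian]

theorem integrable_exp_inner_add_const_stdGaussian (v : F) (c : ℝ) :
    Integrable (fun y => Real.exp (⟪v, y⟫ + c)) (stdGaussian F) := by
  simp_rw [Real.exp_add]
  exact (integrable_exp_inner_stdGaussian v).mul_const _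

/-- The Cameron-Martin formula for the standard Gaussian measure. -/
theorem map_const_add_stdGaussian (v : F) :
    (stdGaussian F).map (fun z => v + z) = (stdGaussian F).withDensity
      (fun y => ENNReal.ofReal (Real.exp (⟪v, y⟫ + -(‖v‖ ^ 2 / 2)))) := by
  have hint := integrable_exp_inner_add_const_stdGaussian v (-(‖v‖ ^ 2 / 2))
  have := isFiniteMeasure_withDensity_ofReal hint.2
  have : IsProbabilityMeasure ((stdGaussian F).map (fun z => v + z)) :=
    Measure.isProbabilityMeasure_map (by fun_prop)
  -- Both measures are finite, so comparing characteristic functions suffices.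
  refine Measure.ext_of_charFun (funext fun t => ?_)
  rw [charFun_apply, charFun_apply, integral_map (by fun_prop)
    (Measurable.aestronglyMeasurable (by fun_prop)),
    integral_withDensity_eq_integral_toReal_smul (by fun_prop) (by simp)]
  have h0 := integral_cexp_inner_stdGaussian (0 : F) t
  have h1 := integral_cexp_inner_stdGaussian v t
  calc ∫ z, Complex.exp (⟪v + z, t⟫ * Complex.I) ∂(stdGaussian F)
      = ∫ z, Complex.exp (⟪v, t⟫ * Complex.I) *
          Complex.exp (⟪z, (0 : F)⟫ + ⟪z, t⟫ * Complex.I) ∂(stdGaussian F) := by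
        refine integral_congr_ae (ae_of_all _ fun z => ?_)
        simp only [inner_add_left, inner_zero_right, ← Complex.exp_add]
        congr 1; push_cast; ring
    _ = Complex.exp (-(‖v‖ ^ 2 / 2)) *
          ∫ y, Complex.exp (⟪y, v⟫ + ⟪y, t⟫ * Complex.I) ∂(stdGaussian F) := by
        rw [integral_const_mul, h0, h1, ← Complex.exp_add, ← Complex.exp_add]
        congr 1; simp; ring
    _ = _ := by
        rw [← integral_const_mul]
        refine integral_congr_ae (ae_of_all _ fun y => ?_)
        simp only [ENNReal.toReal_ofReal (Real.exp_pos _).le, Complex.real_smul,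
          Complex.ofReal_exp, ← Complex.exp_add]
        congr 1
        rw [real_inner_comm v y]; push_cast; ring

theorem integral_comp_const_add_stdGaussian {G : Type*} [NormedAddCommGroup G] [NormedSpace ℝ G]
    (v : F) (f : F → G) :
    ∫ z, f (v + z) ∂(stdGaussian F) =
      ∫ y, Real.exp (⟪v, y⟫ + -(‖v‖ ^ 2 / 2)) • f y ∂(stdGaussian F) := by
  rw [← (measurableEmbedding_addLeft v).integral_map, map_const_add_stdGaussian,
    integral_withDensity_eq_integral_toReal_smul (by fun_prop) (by simp)]
  simp_rw [ENNReal.toReal_ofReal (Real.exp_pos _).le]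

end Gaussian

/-! ### Products with a uniform measure on a finite set, as finite averages -/

section FiniteUniform

variable {α β : Type*} [MeasurableSpace α] [MeasurableSingletonClass α] [MeasurableSpace β]

theorem uniformOn_coe_finset (S : Finset α) :
    uniformOn (S : Set α) = (S.card : ENNReal)⁻¹ • ∑ x ∈ S, Measure.dirac x := by
  classical
  ext t ht
  have h : (S : Set α) ∩ t = ((S.filter (· ∈ t) : Finset α) : Set α) := by ext; simp
  rw [uniformOn, cond_apply S.measurableSet, h, Measure.count_apply_finset,
    Measure.count_apply_finset]
  simp [Measure.dirac_apply' _ ht, Set.indicator_apply]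

theorem uniformOn_coe_finset_prod (S : Finset α) (ν : Measure β) [SFinite ν] :
    (uniformOn (S : Set α)).prod ν =
      (S.card : ENNReal)⁻¹ • ∑ x ∈ S, ν.map (Prod.mk x) := by
  classical
  rw [uniformOn_coe_finset, Measure.prod_smul_left]
  congr 1
  induction S using Finset.induction_on with
  | empty => simp
  | insert x S hx ih => rw [Finset.sum_insert hx, Finset.sum_insert hx, ← ih, Measure.add_prod,
      Measure.dirac_prod]

variable {G : Type*} [NormedAddCommGroup G]

theorem integrable_uniformOn_coe_finset_prod {S : Finset α} {ν : Measure β} [SFinite ν]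
    {f : α × β → G} (hf : ∀ x ∈ S, Integrable (fun z => f (x, z)) ν) :
    Integrable f ((uniformOn (S : Set α)).prod ν) := by
  rcases S.eq_empty_or_nonempty with rfl | hS
  · simp [uniformOn_empty_meas]
  rw [uniformOn_coe_finset_prod]
  refine Integrable.smul_measure ?_ (by simp [hS.ne_empty])
  rw [integrable_finsetSum_measure]
  exact fun x hx => ((measurableEmbedding_prodMk_left x).integrable_map_iff).2 (hf x hx)

theorem integral_uniformOn_coe_finset_prod [NormedSpace ℝ G] {S : Finset α} {ν : Measure β}
    [SFinite ν] {f : α × β → G} (hf : ∀ x ∈ S, Integrable (fun z => f (x, z)) ν) :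
    ∫ ω, f ω ∂((uniformOn (S : Set α)).prod ν) =
      (S.card : ℝ)⁻¹ • ∑ x ∈ S, ∫ z, f (x, z) ∂ν := by
  rw [uniformOn_coe_finset_prod, integral_smul_measure, integral_finsetSum_measure]
  · simp [(measurableEmbedding_prodMk_left _).integral_map]
  · exact fun x hx => ((measurableEmbedding_prodMk_left x).integrable_map_iff).2 (hf x hx)

end FiniteUniform

/-! ### Bayes' formula for the posterior mean and the mean squared error -/

noncomputable section Posterior

open scoped RealInnerProductSpace

variable {α : Type*} {F : Type*} [NormedAddCommGroup F] [InnerProductSpace ℝ F]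

/-- The density at `y` of `a V + Z` with respect to the law of a standard Gaussian `Z`, for a unit
vector `V`. -/
def likelihood (a : ℝ) (V y : F) : ℝ := Real.exp (a * ⟪V, y⟫ + -(a ^ 2 / 2))

theorem likelihood_pos (a : ℝ) (V y : F) : 0 < likelihood a V y := Real.exp_pos _

/-- The sum over `x ∈ S` of the likelihoods at `y` of the signals `V x`. -/
def totalLikelihood (S : Finset α) (V : α → F) (a : ℝ) (y : F) : ℝ :=
  ∑ x ∈ S, likelihood a (V x) y

theorem totalLikelihood_pos {S : Finset α} (hS : S.Nonempty) (V : α → F) (a : ℝ) (y : F) :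
    0 < totalLikelihood S V a y :=
  Finset.sum_pos (fun _ _ => likelihood_pos _ _ _) hS

/-- The mean of `V x` under the posterior law of `x` given the observation `y`. -/
def posteriorMean (S : Finset α) (V : α → F) (a : ℝ) (y : F) : F :=
  (totalLikelihood S V a y)⁻¹ • ∑ x ∈ S, likelihood a (V x) y • V x

theorem norm_posteriorMean_le_one {S : Finset α} (hS : S.Nonempty) {V : α → F}
    (hV : ∀ x ∈ S, ‖V x‖ = 1) (a : ℝ) (y : F) : ‖posteriorMean S V a y‖ ≤ 1 := by
  have hT := totalLikelihood_pos hS V a y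
  rw [posteriorMean, norm_smul, norm_inv, Real.norm_of_nonneg hT.le, inv_mul_le_one₀ hT]
  refine (norm_sum_le _ _).trans (Finset.sum_le_sum fun x hx => ?_)
  rw [norm_smul, hV x hx, mul_one, Real.norm_of_nonneg (likelihood_pos _ _ _).le]

theorem totalLikelihood_smul_posteriorMean {S : Finset α} (hS : S.Nonempty) (V : α → F)
    (a : ℝ) (y : F) : totalLikelihood S V a y • posteriorMean S V a y =
      ∑ x ∈ S, likelihood a (V x) y • V x := by
  rw [posteriorMean, smul_inv_smul₀ (totalLikelihood_pos hS V a y).ne']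

/-- The average over pairs of `1 - ⟪V x, V x'⟫`, weighted by the product of likelihoods. -/
theorem sum_likelihood_mul_norm_sub_posteriorMean {S : Finset α} (hS : S.Nonempty) {V : α → F}
    (hV : ∀ x ∈ S, ‖V x‖ = 1) (a : ℝ) (y : F) :
    ∑ x ∈ S, likelihood a (V x) y * ‖V x - posteriorMean S V a y‖ ^ 2 =
      ∑ x ∈ S, ∑ x' ∈ S, (1 - ⟪V x, V x'⟫) *
        (likelihood a (V x) y * likelihood a (V x') y / totalLikelihood S V a y) := by
  set T := totalLikelihood S V a y with hTdef
  set m := posteriorMean S V a y with hm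
  have hT : 0 < T := totalLikelihood_pos hS V a y
  have hsm : T • m = ∑ x ∈ S, likelihood a (V x) y • V x :=
    totalLikelihood_smul_posteriorMean hS V a y
  have hTS : ∑ x ∈ S, likelihood a (V x) y = T := rfl
  have hinner (w : F) : ∑ x ∈ S, likelihood a (V x) y * ⟪w, V x⟫ = T * ⟪w, m⟫ := by
    rw [← real_inner_smul_right, hsm, inner_sum]
    simp_rw [real_inner_smul_right]
  -- Both sides equal `T - T‖m‖²`, because `T • m = ∑ e_x V x`.
  have hL : ∑ x ∈ S, likelihood a (V x) y * ‖V x - m‖ ^ 2 = T - T * ‖m‖ ^ 2 := by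
    calc ∑ x ∈ S, likelihood a (V x) y * ‖V x - m‖ ^ 2
        = ∑ x ∈ S, (likelihood a (V x) y - 2 * (likelihood a (V x) y * ⟪m, V x⟫) +
            likelihood a (V x) y * ‖m‖ ^ 2) := by
          refine Finset.sum_congr rfl fun x hx => ?_
          rw [norm_sub_sq_real, hV x hx, real_inner_comm]; ring
      _ = _ := by
          rw [Finset.sum_add_distrib, Finset.sum_sub_distrib, ← Finset.mul_sum, ← Finset.sum_mul,
            hinner, hTS, real_inner_self_eq_norm_sq]
          ring
  have hR : ∀ x ∈ S, ∑ x' ∈ S, (1 - ⟪V x, V x'⟫) *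
      (likelihood a (V x) y * likelihood a (V x') y / T) =
      likelihood a (V x) y - likelihood a (V x) y * ⟪m, V x⟫ := by
    intro x _
    have : ∀ x' ∈ S, (1 - ⟪V x, V x'⟫) * (likelihood a (V x) y * likelihood a (V x') y / T) =
        likelihood a (V x) y / T * likelihood a (V x') y -
        likelihood a (V x) y / T * (likelihood a (V x') y * ⟪V x, V x'⟫) := fun _ _ => by ring
    rw [Finset.sum_congr rfl this, Finset.sum_sub_distrib, ← Finset.mul_sum, ← Finset.mul_sum,
      hinner, hTS, real_inner_comm]
    field_simp
  rw [hL, Finset.sum_congr rfl hR, Finset.sum_sub_distrib, hinner, hTS, real_inner_self_eq_norm_sq]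

@[fun_prop]
theorem continuous_likelihood (a : ℝ) (V : F) : Continuous (likelihood a V) := by
  unfold likelihood; fun_prop

theorem continuous_totalLikelihood (S : Finset α) (V : α → F) (a : ℝ) :
    Continuous (totalLikelihood S V a) := by
  unfold totalLikelihood; fun_prop

theorem continuous_posteriorMean {S : Finset α} (hS : S.Nonempty) (V : α → F) (a : ℝ) :
    Continuous (posteriorMean S V a) := by
  unfold posteriorMean
  exact ((continuous_totalLikelihood S V a).inv₀
    fun y => (totalLikelihood_pos hS V a y).ne').smul (by fun_prop)

variable [FiniteDimensional ℝ F] [MeasurableSpace F] [BorelSpace F]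

theorem integrable_likelihood (a : ℝ) (V : F) :
    Integrable (likelihood a V) (stdGaussian F) := by
  have := integrable_exp_inner_add_const_stdGaussian (a • V) (-(a ^ 2 / 2))
  simp only [real_inner_smul_left] at this
  exact this

theorem integral_likelihood (a : ℝ) {V : F} (hV : ‖V‖ = 1) :
    ∫ y, likelihood a V y ∂(stdGaussian F) = 1 := by
  have := integral_exp_inner_add_const_stdGaussian (a • V) (-(a ^ 2 / 2))
  simpa [likelihood, real_inner_smul_left, norm_smul, hV] using this

theorem integral_comp_signal_add {G : Type*} [NormedAddCommGroup G] [NormedSpace ℝ G]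
    (a : ℝ) {V : F} (hV : ‖V‖ = 1) (f : F → G) :
    ∫ z, f (a • V + z) ∂(stdGaussian F) = ∫ y, likelihood a V y • f y ∂(stdGaussian F) := by
  rw [integral_comp_const_add_stdGaussian]
  simp [likelihood, real_inner_smul_left, norm_smul, hV]

variable [MeasurableSpace α] [MeasurableSingletonClass α]

/-- The posterior mean is a bounded continuous function of the observation, so only its integrals
over observable events need checking. Cameron-Martin moves every signal to the same noise law, where
the identity `T • m = ∑ e_x V x` holds pointwise. -/
theorem condExp_signal_ae_eq_posteriorMean {S : Finset α} (hS : S.Nonempty) {V : α → F}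
    (hVm : Measurable V) (hV : ∀ x ∈ S, ‖V x‖ = 1) (a : ℝ) :
    (fun ω : α × F => posteriorMean S V a (a • V ω.1 + ω.2))
      =ᵐ[(uniformOn (S : Set α)).prod (stdGaussian F)]
    ((uniformOn (S : Set α)).prod (stdGaussian F))[fun ω => V ω.1 |
      MeasurableSpace.comap (fun ω : α × F => a • V ω.1 + ω.2) inferInstance] := by
  have : IsProbabilityMeasure (uniformOn (S : Set α)) :=
    isProbabilityMeasure_uniformOn S.finite_toSet hS
  set μ := (uniformOn (S : Set α)).prod (stdGaussian F)
  have hobs : Measurable (fun ω : α × F => a • V ω.1 + ω.2) := by fun_prop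
  have hpm := continuous_posteriorMean hS V a
  have hmean (x : α) : Integrable (fun z => posteriorMean S V a (a • V x + z)) (stdGaussian F) :=
    Integrable.of_bound (by fun_prop) 1
      (ae_of_all _ fun z => norm_posteriorMean_le_one hS hV a _)
  have hf : Integrable (fun ω : α × F => V ω.1) μ :=
    integrable_uniformOn_coe_finset_prod fun x _ => integrable_const (V x)
  have hg : Integrable (fun ω : α × F => posteriorMean S V a (a • V ω.1 + ω.2)) μ :=
    integrable_uniformOn_coe_finset_prod fun x _ => hmean x
  refine ae_eq_condExp_of_forall_setIntegral_eq hobs.comap_le hf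
    (fun s _ _ => hg.integrableOn) (fun s hs _ => ?_)
    (hpm.stronglyMeasurable.comp_measurable (comap_measurable _)).aestronglyMeasurable
  obtain ⟨B, hB, rfl⟩ := hs
  have hBm (x : α) : MeasurableSet ((fun z => a • V x + z) ⁻¹' B) := hB.preimage (by fun_prop)
  rw [← integral_indicator (hB.preimage hobs), ← integral_indicator (hB.preimage hobs),
    integral_uniformOn_coe_finset_prod fun x _ => (hmean x).indicator (hBm x),
    integral_uniformOn_coe_finset_prod fun x _ => (integrable_const (V x)).indicator (hBm x)]
  congr 1
  have hi1 : ∀ x ∈ S, Integrable (fun y => likelihood a (V x) y •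
      B.indicator (posteriorMean S V a) y) (stdGaussian F) := fun x _ => by
    refine (integrable_likelihood a (V x)).smul_bdd 1
      ((hpm.stronglyMeasurable.indicator hB).aestronglyMeasurable) (ae_of_all _ fun y => ?_)
    exact (norm_indicator_le_norm_self _ _).trans (norm_posteriorMean_le_one hS hV a y)
  have hi2 : ∀ x ∈ S, Integrable (fun y => likelihood a (V x) y •
      B.indicator (fun _ => V x) y) (stdGaussian F) := fun x hx => by
    refine (integrable_likelihood a (V x)).smul_bdd 1
      ((stronglyMeasurable_const.indicator hB).aestronglyMeasurable) (ae_of_all _ fun y => ?_)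
    exact (norm_indicator_le_norm_self _ _).trans (hV x hx).le
  calc _ = ∑ x ∈ S, ∫ y, likelihood a (V x) y • B.indicator (posteriorMean S V a) y
          ∂(stdGaussian F) :=
        Finset.sum_congr rfl fun x hx =>
          integral_comp_signal_add a (hV x hx) (B.indicator (posteriorMean S V a))
    _ = ∑ x ∈ S, ∫ y, likelihood a (V x) y • B.indicator (fun _ => V x) y ∂(stdGaussian F) := by
        rw [← integral_finsetSum _ hi1, ← integral_finsetSum _ hi2]
        congr 1
        ext1 y
        by_cases hy : y ∈ B
        · simp only [Set.indicator_of_mem hy, ← Finset.sum_smul]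
          exact totalLikelihood_smul_posteriorMean hS V a y
        · simp [Set.indicator_of_notMem hy]
    _ = _ := (Finset.sum_congr rfl fun x hx =>
          integral_comp_signal_add a (hV x hx) (B.indicator fun _ => V x)).symm

/-- The minimum mean squared error as an integral against the law of the noise. -/
theorem integral_norm_sub_condExp_sq {S : Finset α} (hS : S.Nonempty) {V : α → F}
    (hVm : Measurable V) (hV : ∀ x ∈ S, ‖V x‖ = 1) (a : ℝ) :
    ∫ ω, ‖V ω.1 - (((uniformOn (S : Set α)).prod (stdGaussian F))[fun ω => V ω.1 |
      MeasurableSpace.comap (fun ω : α × F => a • V ω.1 + ω.2) inferInstance]) ω‖ ^ 2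
      ∂((uniformOn (S : Set α)).prod (stdGaussian F)) =
    ∫ y, (S.card : ℝ)⁻¹ * ∑ x ∈ S, ∑ x' ∈ S, (1 - ⟪V x, V x'⟫) *
      (likelihood a (V x) y * likelihood a (V x') y / totalLikelihood S V a y)
      ∂(stdGaussian F) := by
  have hpm := continuous_posteriorMean hS V a
  have hbound (x : α) (hx : x ∈ S) (y : F) : ‖‖V x - posteriorMean S V a y‖ ^ 2‖ ≤ 4 := by
    have h := norm_sub_le (V x) (posteriorMean S V a y)
    rw [hV x hx] at h
    have h' := norm_posteriorMean_le_one hS hV a y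
    rw [Real.norm_of_nonneg (by positivity)]
    nlinarith [norm_nonneg (V x - posteriorMean S V a y)]
  have hint : ∀ x ∈ S, Integrable (fun z => ‖V x - posteriorMean S V a (a • V x + z)‖ ^ 2)
      (stdGaussian F) := fun x hx =>
    Integrable.of_bound (by fun_prop) 4 (ae_of_all _ fun z => hbound x hx _)
  have hint' : ∀ x ∈ S, Integrable
      (fun y => likelihood a (V x) y * ‖V x - posteriorMean S V a y‖ ^ 2) (stdGaussian F) :=
    fun x hx => (integrable_likelihood a (V x)).mul_bdd (c := 4) (by fun_prop)
      (ae_of_all _ fun y => hbound x hx y)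
  have hae := condExp_signal_ae_eq_posteriorMean hS hVm hV a
  rw [integral_congr_ae (g := fun ω : α × F =>
      ‖V ω.1 - posteriorMean S V a (a • V ω.1 + ω.2)‖ ^ 2)
      (by filter_upwards [hae] with ω hω; rw [hω]),
    integral_uniformOn_coe_finset_prod hint, smul_eq_mul, integral_const_mul]
  congr 1
  simp_rw [← sum_likelihood_mul_norm_sub_posteriorMean hS hV]
  rw [integral_finsetSum _ hint']
  exact Finset.sum_congr rfl fun x hx =>
    integral_comp_signal_add a (hV x hx) fun y => ‖V x - posteriorMean S V a y‖ ^ 2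

end Posterior

/-! ### Truncated moment bounds on the posterior error -/

noncomputable section Bounds

open scoped RealInnerProductSpace

variable {α : Type*} {F : Type*} [NormedAddCommGroup F] [InnerProductSpace ℝ F]

/-- The likelihood of `V` times an exponential factor, which is at least `1` where `⟪V, y⟫` deviates
from `a` by at least `τ` (upwards if `τ ≥ 0`, downwards if `τ ≤ 0`). -/
def tiltedLikelihood (a τ : ℝ) (V y : F) : ℝ :=
  Real.exp ((a + τ) * ⟪V, y⟫ + (-(a ^ 2 / 2) - τ * a - τ ^ 2))

theorem tiltedLikelihood_pos (a τ : ℝ) (V y : F) : 0 < tiltedLikelihood a τ V y :=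
  Real.exp_pos _

theorem likelihood_le_tiltedLikelihood {a τ : ℝ} {V y : F} (h : 0 ≤ τ * (⟪V, y⟫ - a - τ)) :
    likelihood a V y ≤ tiltedLikelihood a τ V y :=
  Real.exp_le_exp.2 (by nlinarith)

theorem sum_likelihood_mul_div_totalLikelihood {S : Finset α} (hS : S.Nonempty) (V : α → F)
    (a : ℝ) (y : F) (g : α → ℝ) :
    ∑ x ∈ S, ∑ x' ∈ S, g x * likelihood a (V x') y / totalLikelihood S V a y =
      ∑ x ∈ S, g x := by
  refine Finset.sum_congr rfl fun x _ => ?_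
  rw [← Finset.sum_div, ← Finset.mul_sum]
  exact mul_div_cancel_right₀ _ (totalLikelihood_pos hS V a y).ne'

theorem sum_likelihood_mul_div_totalLikelihood' {S : Finset α} (hS : S.Nonempty) (V : α → F)
    (a : ℝ) (y : F) (g : α → ℝ) :
    ∑ x ∈ S, ∑ x' ∈ S, g x' * likelihood a (V x) y / totalLikelihood S V a y =
      ∑ x ∈ S, g x := by
  rw [Finset.sum_comm, sum_likelihood_mul_div_totalLikelihood hS]

theorem inner_le_one_of_unit {v w : F} (hv : ‖v‖ = 1) (hw : ‖w‖ = 1) : ⟪v, w⟫ ≤ 1 := by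
  simpa [hv, hw] using real_inner_le_norm v w

theorem neg_one_le_inner_of_unit {v w : F} (hv : ‖v‖ = 1) (hw : ‖w‖ = 1) : -1 ≤ ⟪v, w⟫ := by
  have := (abs_le.1 (abs_real_inner_le_norm v w)).1
  simpa [hv, hw] using this

theorem norm_add_sq_of_unit {v w : F} (hv : ‖v‖ = 1) (hw : ‖w‖ = 1) :
    ‖v + w‖ ^ 2 = 2 * (1 + ⟪v, w⟫) := by
  rw [norm_add_sq_real, hv, hw]; ring

/-- A bound for the product of two likelihoods on the event that both inner products are at most
`a + τ`. -/
def upperPairBound (a τ : ℝ) (v w y : F) : ℝ :=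
  Real.exp ((a - a * ⟪v, w⟫ / (1 + ⟪v, w⟫)) * ⟪v + w, y⟫ +
    (-a ^ 2 + 2 * (a * ⟪v, w⟫ / (1 + ⟪v, w⟫)) * (a + τ)))

theorem likelihood_mul_le_upperPairBound {a τ : ℝ} (ha : 0 ≤ a) {v w y : F} (hvw : 0 ≤ ⟪v, w⟫)
    (hv : ⟪v, y⟫ ≤ a + τ) (hw : ⟪w, y⟫ ≤ a + τ) :
    likelihood a v y * likelihood a w y ≤ upperPairBound a τ v w y := by
  -- The bound multiplies the product by `exp(-s(⟪v + w, y⟫ - 2(a + τ)))`, which is at least `1` on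
  -- the event. This `s` makes the total tilt `a/(1+ρ)`, which minimizes the Gaussian mean.
  rw [likelihood, likelihood, ← Real.exp_add, upperPairBound, inner_add_left]
  set s := a * ⟪v, w⟫ / (1 + ⟪v, w⟫)
  have hs : 0 ≤ s := by positivity
  refine Real.exp_le_exp.2 ?_
  nlinarith [mul_nonneg hs (sub_nonneg.2 hv), mul_nonneg hs (sub_nonneg.2 hw)]

/-- A bound for the square root of the product of two likelihoods on the event that both inner
products are at least `a - τ`. -/
def lowerPairBound (a τ : ℝ) (v w y : F) : ℝ :=
  Real.exp ((a / 2 + a * ((1 - max ⟪v, w⟫ 0) / (1 + max ⟪v, w⟫ 0)) / 2) * ⟪v + w, y⟫ +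
    (-(a ^ 2 / 2) - a * ((1 - max ⟪v, w⟫ 0) / (1 + max ⟪v, w⟫ 0)) * (a - τ)))

theorem likelihood_mul_div_le_lowerPairBound {S : Finset α} {V : α → F}
    (hV : ∀ x ∈ S, ‖V x‖ = 1) {a τ : ℝ} (ha : 0 ≤ a) {y : F} {x x' : α} (hx : x ∈ S) (hx' : x' ∈ S)
    (h : a - τ ≤ ⟪V x, y⟫) (h' : a - τ ≤ ⟪V x', y⟫) :
    likelihood a (V x) y * likelihood a (V x') y / totalLikelihood S V a y ≤
      lowerPairBound a τ (V x) (V x') y := by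
  have hT := totalLikelihood_pos ⟨x, hx⟩ V a y
  have hle (z : α) (hz : z ∈ S) : likelihood a (V z) y ≤ totalLikelihood S V a y :=
    Finset.single_le_sum (f := fun z => likelihood a (V z) y)
      (fun _ _ => (likelihood_pos _ _ _).le) hz
  -- `w` is the geometric mean of the two likelihoods; both are at most `T`, so `w ≤ T` and `w²/T ≤
  -- w`.
  set w := Real.exp ((a * (⟪V x, y⟫ + ⟪V x', y⟫) - a ^ 2) / 2) with hw
  have hw0 : 0 < w := Real.exp_pos _
  have hww : likelihood a (V x) y * likelihood a (V x') y = w ^ 2 := by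
    rw [likelihood, likelihood, ← Real.exp_add, hw, ← Real.exp_nat_mul]
    congr 1; push_cast; ring
  have hwT : w ≤ totalLikelihood S V a y := by
    refine le_of_sq_le_sq ?_ hT.le
    rw [← hww, sq]
    exact mul_le_mul (hle x hx) (hle x' hx') (likelihood_pos _ _ _).le hT.le
  have hstep : w ^ 2 / totalLikelihood S V a y ≤ w := by
    rw [div_le_iff₀ hT]; nlinarith
  rw [hww]
  refine hstep.trans (Real.exp_le_exp.2 ?_)
  rw [inner_add_left]
  have hr1 : max ⟪V x, V x'⟫ 0 ≤ 1 :=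
    max_le (inner_le_one_of_unit (hV x hx) (hV x' hx')) zero_le_one
  have hr0 : 0 ≤ max ⟪V x, V x'⟫ 0 := le_max_right _ _
  set t := (1 - max ⟪V x, V x'⟫ 0) / (1 + max ⟪V x, V x'⟫ 0)
  have ht : 0 ≤ a * t := mul_nonneg ha (div_nonneg (by linarith) (by linarith))
  nlinarith [mul_nonneg ht (sub_nonneg.2 h), mul_nonneg ht (sub_nonneg.2 h')]

/-- The weights `e_x e_{x'}/T` sum to `T`, so the loss from inserting `1 - ρ` is split: pairs with
`ρ < ε` lose at most `εT`; the others fall under a tilted likelihood if one inner product exceeds `a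
+ τ`, and under the truncated second moment otherwise. The latter needs `T ≥ δM` in the denominator.
-/
theorem sum_one_sub_inner_lower_bound {S : Finset α} (hS : S.Nonempty) {V : α → F}
    (hV : ∀ x ∈ S, ‖V x‖ = 1) {a τ ε δ : ℝ} (ha : 0 ≤ a) (hτ : 0 ≤ τ) (hε : 0 ≤ ε) (hδ : 0 < δ)
    (y : F) :
    totalLikelihood S V a y ≤ ∑ x ∈ S, ∑ x' ∈ S, (1 - ⟪V x, V x'⟫) *
        (likelihood a (V x) y * likelihood a (V x') y / totalLikelihood S V a y) +
      (ε * totalLikelihood S V a y + 2 * ∑ x ∈ S, tiltedLikelihood a τ (V x) y + δ * S.card +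
        (δ * S.card)⁻¹ * ∑ x ∈ S, ∑ x' ∈ S,
          if ε ≤ ⟪V x, V x'⟫ then upperPairBound a τ (V x) (V x') y else 0) := by
  set T := totalLikelihood S V a y with hTdef
  have hT : 0 < T := totalLikelihood_pos hS V a y
  have hM : (0 : ℝ) < S.card := by exact_mod_cast hS.card_pos
  have hρ (x) (hx : x ∈ S) (x') (hx' : x' ∈ S) : 0 ≤ 1 - ⟪V x, V x'⟫ :=
    sub_nonneg.2 (inner_le_one_of_unit (hV x hx) (hV x' hx'))
  have hb (x x' : α) :
      0 ≤ if ε ≤ ⟪V x, V x'⟫ then upperPairBound a τ (V x) (V x') y else 0 := by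
    split_ifs
    exacts [(Real.exp_pos _).le, le_rfl]
  have h1 : 0 ≤ ∑ x ∈ S, ∑ x' ∈ S, (1 - ⟪V x, V x'⟫) *
      (likelihood a (V x) y * likelihood a (V x') y / T) :=
    Finset.sum_nonneg fun x hx => Finset.sum_nonneg fun x' hx' => mul_nonneg (hρ x hx x' hx')
      (div_nonneg (mul_nonneg (likelihood_pos _ _ _).le (likelihood_pos _ _ _).le) hT.le)
  have h2 : 0 ≤ ∑ x ∈ S, tiltedLikelihood a τ (V x) y :=
    Finset.sum_nonneg fun _ _ => (tiltedLikelihood_pos _ _ _ _).le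
  have h3 : 0 ≤ (δ * S.card)⁻¹ * ∑ x ∈ S, ∑ x' ∈ S,
      if ε ≤ ⟪V x, V x'⟫ then upperPairBound a τ (V x) (V x') y else 0 :=
    mul_nonneg (by positivity)
      (Finset.sum_nonneg fun x _ => Finset.sum_nonneg fun x' _ => hb x x')
  rcases lt_or_ge T (δ * S.card) with hlt | hge
  -- When `T < δM`, the term `δM` alone dominates.
  · have : 0 ≤ ε * T := by positivity
    linarith
  have key : ∀ x ∈ S, ∀ x' ∈ S, likelihood a (V x) y * likelihood a (V x') y / T ≤
      (1 - ⟪V x, V x'⟫) * (likelihood a (V x) y * likelihood a (V x') y / T) +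
      ε * (likelihood a (V x) y * likelihood a (V x') y / T) +
      (tiltedLikelihood a τ (V x) y * likelihood a (V x') y / T +
        tiltedLikelihood a τ (V x') y * likelihood a (V x) y / T) +
      (δ * S.card)⁻¹ *
        (if ε ≤ ⟪V x, V x'⟫ then upperPairBound a τ (V x) (V x') y else 0) := by
    intro x hx x' hx'
    have he := likelihood_pos a (V x) y
    have he' := likelihood_pos a (V x') y
    have hA := tiltedLikelihood_pos a τ (V x) y
    have hA' := tiltedLikelihood_pos a τ (V x') y
    have hW : 0 ≤ likelihood a (V x) y * likelihood a (V x') y / T := by positivity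
    have hP : 0 ≤ tiltedLikelihood a τ (V x) y * likelihood a (V x') y / T := by positivity
    have hP' : 0 ≤ tiltedLikelihood a τ (V x') y * likelihood a (V x) y / T := by positivity
    by_cases hc : ε ≤ ⟪V x, V x'⟫
    · rw [if_pos hc]
      have hu0 : 0 ≤ (δ * S.card)⁻¹ * upperPairBound a τ (V x) (V x') y :=
        mul_nonneg (by positivity) (Real.exp_pos _).le
      suffices likelihood a (V x) y * likelihood a (V x') y / T ≤
          tiltedLikelihood a τ (V x) y * likelihood a (V x') y / T +
            tiltedLikelihood a τ (V x') y * likelihood a (V x) y / T +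
          (δ * S.card)⁻¹ * upperPairBound a τ (V x) (V x') y by
        have := mul_nonneg (hρ x hx x' hx') hW
        have := mul_nonneg hε hW
        linarith
      rcases le_total ⟪V x, y⟫ (a + τ) with hv | hv
      · rcases le_total ⟪V x', y⟫ (a + τ) with hw | hw
        · have := likelihood_mul_le_upperPairBound ha (hε.trans hc) hv hw
          have h4 : likelihood a (V x) y * likelihood a (V x') y / T ≤
              upperPairBound a τ (V x) (V x') y / (δ * S.card) :=
            div_le_div₀ (Real.exp_pos _).le this (by positivity) hge
          rw [div_eq_inv_mul _ (δ * _)] at h4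
          linarith
        · have h4 : likelihood a (V x') y * likelihood a (V x) y / T ≤
              tiltedLikelihood a τ (V x') y * likelihood a (V x) y / T := by
            gcongr
            exact likelihood_le_tiltedLikelihood (mul_nonneg hτ (by linarith))
          rw [mul_comm (likelihood a (V x') y)] at h4
          linarith
      · have h4 : likelihood a (V x) y * likelihood a (V x') y / T ≤
            tiltedLikelihood a τ (V x) y * likelihood a (V x') y / T := by
          gcongr
          exact likelihood_le_tiltedLikelihood (mul_nonneg hτ (by linarith))
        linarith
    · rw [if_neg hc]
      nlinarith [not_le.1 hc]
  have hsum := Finset.sum_le_sum fun x hx => Finset.sum_le_sum fun x' hx' => key x hx x' hx'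
  simp only [Finset.sum_add_distrib, ← Finset.mul_sum] at hsum
  rw [sum_likelihood_mul_div_totalLikelihood hS V a y (fun x => likelihood a (V x) y),
    sum_likelihood_mul_div_totalLikelihood hS V a y (fun x => tiltedLikelihood a τ (V x) y),
    sum_likelihood_mul_div_totalLikelihood' hS V a y (fun x => tiltedLikelihood a τ (V x) y)]
    at hsum
  change T ≤ _ + ε * T + _ + _ at hsum
  have : 0 ≤ δ * S.card := by positivity
  linarith

/-- Pairs with `ρ > 1 - ε` contribute at most `εT`. For the others `1 - ρ ≤ 2`, and the weight is
bounded by a tilted likelihood if an inner product is below `a - τ`, else by the truncated geometric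
mean. -/
theorem sum_one_sub_inner_upper_bound {S : Finset α} (hS : S.Nonempty) {V : α → F}
    (hV : ∀ x ∈ S, ‖V x‖ = 1) {a τ ε : ℝ} (ha : 0 ≤ a) (hτ : 0 ≤ τ) (hε : 0 ≤ ε) (y : F) :
    ∑ x ∈ S, ∑ x' ∈ S, (1 - ⟪V x, V x'⟫) *
        (likelihood a (V x) y * likelihood a (V x') y / totalLikelihood S V a y) ≤
      ε * totalLikelihood S V a y + 4 * ∑ x ∈ S, tiltedLikelihood a (-τ) (V x) y +
        2 * ∑ x ∈ S, ∑ x' ∈ S,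
          if ⟪V x, V x'⟫ ≤ 1 - ε then lowerPairBound a τ (V x) (V x') y else 0 := by
  set T := totalLikelihood S V a y with hTdef
  have hT : 0 < T := totalLikelihood_pos hS V a y
  have key : ∀ x ∈ S, ∀ x' ∈ S,
      (1 - ⟪V x, V x'⟫) * (likelihood a (V x) y * likelihood a (V x') y / T) ≤
      ε * (likelihood a (V x) y * likelihood a (V x') y / T) +
      2 * (tiltedLikelihood a (-τ) (V x) y * likelihood a (V x') y / T +
        tiltedLikelihood a (-τ) (V x') y * likelihood a (V x) y / T) +
      2 * (if ⟪V x, V x'⟫ ≤ 1 - ε then lowerPairBound a τ (V x) (V x') y else 0) := by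
    intro x hx x' hx'
    have he := likelihood_pos a (V x) y
    have he' := likelihood_pos a (V x') y
    have hA := tiltedLikelihood_pos a (-τ) (V x) y
    have hA' := tiltedLikelihood_pos a (-τ) (V x') y
    have hW : 0 ≤ likelihood a (V x) y * likelihood a (V x') y / T := by positivity
    have hP : 0 ≤ tiltedLikelihood a (-τ) (V x) y * likelihood a (V x') y / T := by positivity
    have hP' : 0 ≤ tiltedLikelihood a (-τ) (V x') y * likelihood a (V x) y / T := by positivity
    have hρ := neg_one_le_inner_of_unit (hV x hx) (hV x' hx')
    by_cases hc : ⟪V x, V x'⟫ ≤ 1 - ε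
    · rw [if_pos hc]
      have hu0 : 0 ≤ lowerPairBound a τ (V x) (V x') y := (Real.exp_pos _).le
      suffices likelihood a (V x) y * likelihood a (V x') y / T ≤
          tiltedLikelihood a (-τ) (V x) y * likelihood a (V x') y / T +
            tiltedLikelihood a (-τ) (V x') y * likelihood a (V x) y / T +
          lowerPairBound a τ (V x) (V x') y by
        have := mul_nonneg hε hW
        nlinarith
      rcases le_total (a - τ) ⟪V x, y⟫ with hv | hv
      · rcases le_total (a - τ) ⟪V x', y⟫ with hw | hw
        · have := likelihood_mul_div_le_lowerPairBound hV ha hx hx' hv hw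
          linarith
        · have h4 : likelihood a (V x') y * likelihood a (V x) y / T ≤
              tiltedLikelihood a (-τ) (V x') y * likelihood a (V x) y / T := by
            gcongr
            exact likelihood_le_tiltedLikelihood
              (mul_nonneg_of_nonpos_of_nonpos (by linarith) (by linarith))
          rw [mul_comm (likelihood a (V x') y)] at h4
          linarith
      · have h4 : likelihood a (V x) y * likelihood a (V x') y / T ≤
            tiltedLikelihood a (-τ) (V x) y * likelihood a (V x') y / T := by
          gcongr
          exact likelihood_le_tiltedLikelihood
            (mul_nonneg_of_nonpos_of_nonpos (by linarith) (by linarith))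
        linarith
    · rw [if_neg hc]
      nlinarith [not_le.1 hc]
  have hsum := Finset.sum_le_sum fun x hx => Finset.sum_le_sum fun x' hx' => key x hx x' hx'
  simp only [Finset.sum_add_distrib, ← Finset.mul_sum] at hsum
  rw [sum_likelihood_mul_div_totalLikelihood hS V a y (fun x => likelihood a (V x) y),
    sum_likelihood_mul_div_totalLikelihood hS V a y (fun x => tiltedLikelihood a (-τ) (V x) y),
    sum_likelihood_mul_div_totalLikelihood' hS V a y (fun x => tiltedLikelihood a (-τ) (V x) y)]
    at hsum
  change _ ≤ ε * T + _ + _ at hsum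
  linarith

/-- The subtracted part is `‖∑ e_x V x‖² / T ≥ 0`. -/
theorem sum_one_sub_inner_le_totalLikelihood {S : Finset α} (hS : S.Nonempty) (V : α → F)
    (a : ℝ) (y : F) :
    ∑ x ∈ S, ∑ x' ∈ S, (1 - ⟪V x, V x'⟫) *
        (likelihood a (V x) y * likelihood a (V x') y / totalLikelihood S V a y) ≤
      totalLikelihood S V a y := by
  set T := totalLikelihood S V a y with hTdef
  have hT : 0 < T := totalLikelihood_pos hS V a y
  have h1 := sum_likelihood_mul_div_totalLikelihood hS V a y fun x => likelihood a (V x) y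
  have h2 : ∑ x ∈ S, ∑ x' ∈ S, ⟪V x, V x'⟫ *
      (likelihood a (V x) y * likelihood a (V x') y / T) =
      ‖∑ x ∈ S, likelihood a (V x) y • V x‖ ^ 2 / T := by
    rw [← real_inner_self_eq_norm_sq, sum_inner, Finset.sum_div]
    refine Finset.sum_congr rfl fun x _ => ?_
    rw [inner_sum, Finset.sum_div]
    refine Finset.sum_congr rfl fun x' _ => ?_
    rw [real_inner_smul_left, real_inner_smul_right]; ring
  simp only [one_sub_mul, Finset.sum_sub_distrib]
  rw [h1, h2]
  change T - _ ≤ T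
  have : 0 ≤ ‖∑ x ∈ S, likelihood a (V x) y • V x‖ ^ 2 / T := by positivity
  linarith

variable [FiniteDimensional ℝ F] [MeasurableSpace F] [BorelSpace F]

theorem integrable_exp_smul_inner_add (c d : ℝ) (v : F) :
    Integrable (fun y => Real.exp (c * ⟪v, y⟫ + d)) (stdGaussian F) := by
  have := integrable_exp_inner_add_const_stdGaussian (c • v) d
  simpa only [real_inner_smul_left] using this

theorem integral_exp_smul_inner_add (c d : ℝ) (v : F) :
    ∫ y, Real.exp (c * ⟪v, y⟫ + d) ∂(stdGaussian F) = Real.exp (c ^ 2 * ‖v‖ ^ 2 / 2 + d) := by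
  have := integral_exp_inner_add_const_stdGaussian (c • v) d
  simpa only [real_inner_smul_left, norm_smul, mul_pow, Real.norm_eq_abs, sq_abs] using this

/-- This is the Chernoff bound for the planted law, under which `⟪v, y⟫` is normal with mean `a` and
variance `1`. -/
theorem integral_tiltedLikelihood (a τ : ℝ) {v : F} (hv : ‖v‖ = 1) :
    ∫ y, tiltedLikelihood a τ v y ∂(stdGaussian F) = Real.exp (-(τ ^ 2 / 2)) := by
  simp only [tiltedLikelihood]
  rw [integral_exp_smul_inner_add, hv]
  congr 1; ring

theorem integral_upperPairBound (a τ : ℝ) {v w : F} (hv : ‖v‖ = 1) (hw : ‖w‖ = 1)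
    (hvw : 0 ≤ ⟪v, w⟫) :
    ∫ y, upperPairBound a τ v w y ∂(stdGaussian F) =
      Real.exp ((a ^ 2 + 2 * τ * a) * (⟪v, w⟫ / (1 + ⟪v, w⟫))) := by
  simp only [upperPairBound]
  rw [integral_exp_smul_inner_add, norm_add_sq_of_unit hv hw]
  congr 1
  have : 1 + ⟪v, w⟫ ≠ 0 := by positivity
  field_simp
  ring

theorem integral_lowerPairBound_le (a τ : ℝ) {v w : F} (hv : ‖v‖ = 1) (hw : ‖w‖ = 1) :
    ∫ y, lowerPairBound a τ v w y ∂(stdGaussian F) ≤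
      Real.exp (-(a ^ 2 / 2 - τ * a) * ((1 - max ⟪v, w⟫ 0) / (1 + max ⟪v, w⟫ 0))) := by
  simp only [lowerPairBound]
  rw [integral_exp_smul_inner_add, norm_add_sq_of_unit hv hw]
  refine Real.exp_le_exp.2 ?_
  have h0 : 0 ≤ max ⟪v, w⟫ 0 := le_max_right _ _
  have h1 : ⟪v, w⟫ ≤ max ⟪v, w⟫ 0 := le_max_left _ _
  set r := max ⟪v, w⟫ 0
  have hr : 1 + r ≠ 0 := by positivity
  -- Replacing `ρ` by `r = max ρ 0` only increases the variance of the exponent, and avoids the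
  -- singularity of `(1-ρ)/(1+ρ)` at `ρ = -1`.
  have h2 : (a / 2 + a * ((1 - r) / (1 + r)) / 2) ^ 2 * (2 * (1 + ⟪v, w⟫)) / 2 ≤
      (a / 2 + a * ((1 - r) / (1 + r)) / 2) ^ 2 * (2 * (1 + r)) / 2 := by gcongr
  refine (add_le_add_left h2 _).trans (le_of_eq ?_)
  field_simp
  ring

theorem integrable_totalLikelihood (S : Finset α) (V : α → F) (a : ℝ) :
    Integrable (totalLikelihood S V a) (stdGaussian F) :=
  integrable_finsetSum _ fun x _ => integrable_likelihood a (V x)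

theorem integral_totalLikelihood {S : Finset α} {V : α → F} (hV : ∀ x ∈ S, ‖V x‖ = 1) (a : ℝ) :
    ∫ y, totalLikelihood S V a y ∂(stdGaussian F) = S.card := by
  simp only [totalLikelihood]
  rw [integral_finsetSum _ fun x _ => integrable_likelihood a (V x),
    Finset.sum_congr rfl fun x hx => integral_likelihood a (hV x hx)]
  simp

theorem integrable_sum_one_sub_inner {S : Finset α} (hS : S.Nonempty) (V : α → F) (a : ℝ) :
    Integrable (fun y => ∑ x ∈ S, ∑ x' ∈ S, (1 - ⟪V x, V x'⟫) *
      (likelihood a (V x) y * likelihood a (V x') y / totalLikelihood S V a y))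
      (stdGaussian F) := by
  refine integrable_finsetSum _ fun x _ => integrable_finsetSum _ fun x' hx' =>
    Integrable.const_mul ?_ _
  refine (integrable_likelihood a (V x)).mono' ?_ (ae_of_all _ fun y => ?_)
  · exact (Continuous.div (by fun_prop) (continuous_totalLikelihood S V a)
      fun y => (totalLikelihood_pos hS V a y).ne').aestronglyMeasurable
  · have h1 := likelihood_pos a (V x) y
    have h2 := likelihood_pos a (V x') y
    have h3 := totalLikelihood_pos hS V a y
    rw [Real.norm_of_nonneg (by positivity), mul_div_assoc]
    refine mul_le_of_le_one_right h1.le ((div_le_one h3).2 ?_)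
    exact Finset.single_le_sum (f := fun z => likelihood a (V z) y)
      (fun _ _ => (likelihood_pos _ _ _).le) hx'

omit [BorelSpace F] in
theorem integral_sum_ite_le {S : Finset α} {p : α → α → Prop} [∀ x x', Decidable (p x x')]
    {f : α → α → F → ℝ} (hf : ∀ x x', Integrable (f x x') (stdGaussian F)) {B : α → α → ℝ}
    (hB : ∀ x ∈ S, ∀ x' ∈ S, 0 ≤ B x x')
    (hfB : ∀ x ∈ S, ∀ x' ∈ S, p x x' → ∫ y, f x x' y ∂(stdGaussian F) ≤ B x x') :
    Integrable (fun y => ∑ x ∈ S, ∑ x' ∈ S, if p x x' then f x x' y else 0) (stdGaussian F) ∧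
    ∫ y, (∑ x ∈ S, ∑ x' ∈ S, if p x x' then f x x' y else 0) ∂(stdGaussian F) ≤
      ∑ x ∈ S, ∑ x' ∈ S, B x x' := by
  have hi (x x' : α) : Integrable (fun y => if p x x' then f x x' y else 0) (stdGaussian F) := by
    split_ifs
    exacts [hf x x', integrable_zero _ _ _]
  refine ⟨integrable_finsetSum _ fun x _ => integrable_finsetSum _ fun x' _ => hi x x', ?_⟩
  rw [integral_finsetSum _ fun x _ => integrable_finsetSum _ fun x' _ => hi x x']
  refine Finset.sum_le_sum fun x hx => ?_
  rw [integral_finsetSum _ fun x' _ => hi x x']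
  refine Finset.sum_le_sum fun x' hx' => ?_
  split_ifs with h
  · exact hfB x hx x' hx' h
  · simpa using hB x hx x' hx'

/-- The integral `(1/|S|) ∫ ∑ (1 - ⟪V x, V x'⟫) e_x e_{x'} / ∑ e` of the mean squared error. -/
def posteriorError (S : Finset α) (V : α → F) (a : ℝ) : ℝ :=
  ∫ y, (S.card : ℝ)⁻¹ * ∑ x ∈ S, ∑ x' ∈ S, (1 - ⟪V x, V x'⟫) *
      (likelihood a (V x) y * likelihood a (V x') y / totalLikelihood S V a y)
      ∂(stdGaussian F)

theorem posteriorError_le_one {S : Finset α} (hS : S.Nonempty) {V : α → F}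
    (hV : ∀ x ∈ S, ‖V x‖ = 1) (a : ℝ) : posteriorError S V a ≤ 1 := by
  have hM : (0 : ℝ) < S.card := by exact_mod_cast hS.card_pos
  rw [posteriorError, integral_const_mul, inv_mul_le_one₀ hM, ← integral_totalLikelihood hV a]
  exact integral_mono (integrable_sum_one_sub_inner hS V a) (integrable_totalLikelihood S V a)
    (sum_one_sub_inner_le_totalLikelihood hS V a)

omit [BorelSpace F] in
theorem posteriorError_nonneg {S : Finset α} {V : α → F}
    (hV : ∀ x ∈ S, ‖V x‖ = 1) (a : ℝ) : 0 ≤ posteriorError S V a := by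
  refine integral_nonneg fun y => mul_nonneg (by positivity) (Finset.sum_nonneg fun x hx =>
    Finset.sum_nonneg fun x' hx' => mul_nonneg
      (sub_nonneg.2 (inner_le_one_of_unit (hV x hx) (hV x' hx'))) ?_)
  have h3 : 0 < totalLikelihood S V a y := totalLikelihood_pos ⟨x, hx⟩ V a y
  exact div_nonneg (mul_nonneg (likelihood_pos _ _ _).le (likelihood_pos _ _ _).le) h3.le

theorem integrable_tiltedLikelihood (a τ : ℝ) (v : F) :
    Integrable (tiltedLikelihood a τ v) (stdGaussian F) :=
  integrable_exp_smul_inner_add _ _ _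

theorem integral_sum_tiltedLikelihood {S : Finset α} {V : α → F} (hV : ∀ x ∈ S, ‖V x‖ = 1)
    (a τ : ℝ) : ∫ y, (∑ x ∈ S, tiltedLikelihood a τ (V x) y) ∂(stdGaussian F) =
      S.card * Real.exp (-(τ ^ 2 / 2)) := by
  rw [integral_finsetSum _ fun x _ => integrable_tiltedLikelihood a τ (V x),
    Finset.sum_congr rfl fun x hx => integral_tiltedLikelihood a τ (hV x hx)]
  simp

theorem one_sub_posteriorError_le {S : Finset α} (hS : S.Nonempty) {V : α → F}
    (hV : ∀ x ∈ S, ‖V x‖ = 1) {a τ ε δ : ℝ} (ha : 0 ≤ a) (hτ : 0 ≤ τ) (hε : 0 ≤ ε) (hδ : 0 < δ)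
    {B : α → α → ℝ} (hB0 : ∀ x ∈ S, ∀ x' ∈ S, 0 ≤ B x x')
    (hB : ∀ x ∈ S, ∀ x' ∈ S, ε ≤ ⟪V x, V x'⟫ →
      Real.exp ((a ^ 2 + 2 * τ * a) * (⟪V x, V x'⟫ / (1 + ⟪V x, V x'⟫))) ≤ B x x') :
    1 - posteriorError S V a ≤ ε + 2 * Real.exp (-(τ ^ 2 / 2)) + δ +
      δ⁻¹ * ((S.card : ℝ)⁻¹ ^ 2 * ∑ x ∈ S, ∑ x' ∈ S, B x x') := by
  have hM : (0 : ℝ) < S.card := by exact_mod_cast hS.card_pos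
  obtain ⟨hi, hle⟩ := integral_sum_ite_le (S := S) (B := B)
    (p := fun x x' => ε ≤ ⟪V x, V x'⟫) (f := fun x x' => upperPairBound a τ (V x) (V x'))
    (fun x x' => integrable_exp_smul_inner_add _ _ _) hB0 fun x hx x' hx' h =>
      (integral_upperPairBound a τ (hV x hx) (hV x' hx') (hε.trans h)).le.trans (hB x hx x' hx' h)
  have hiT := integrable_totalLikelihood S V a
  have hit : Integrable (fun y => ∑ x ∈ S, tiltedLikelihood a τ (V x) y) (stdGaussian F) :=
    integrable_finsetSum _ fun x _ => integrable_tiltedLikelihood a τ (V x)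
  have hiE := integrable_sum_one_sub_inner hS V a
  have hmono := integral_mono hiT (hiE.add ((((hiT.const_mul ε).add (hit.const_mul 2)).add
    (integrable_const (δ * S.card))).add (hi.const_mul (δ * S.card)⁻¹)))
    (sum_one_sub_inner_lower_bound hS hV ha hτ hε hδ)
  rw [integral_add' hiE ((((hiT.const_mul ε).add (hit.const_mul 2)).add
      (integrable_const (δ * S.card))).add (hi.const_mul (δ * S.card)⁻¹)),
    integral_add' (((hiT.const_mul ε).add (hit.const_mul 2)).add
      (integrable_const (δ * S.card))) (hi.const_mul (δ * S.card)⁻¹),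
    integral_add' ((hiT.const_mul ε).add (hit.const_mul 2)) (integrable_const (δ * S.card)),
    integral_add' (hiT.const_mul ε) (hit.const_mul 2), integral_const_mul ε, integral_const_mul 2,
    integral_const_mul (δ * S.card)⁻¹, integral_totalLikelihood hV,
    integral_sum_tiltedLikelihood hV] at hmono
  simp only [integral_const, probReal_univ, one_smul] at hmono
  rw [posteriorError, integral_const_mul]
  set E := ∫ y, (∑ x ∈ S, ∑ x' ∈ S, (1 - ⟪V x, V x'⟫) *
      (likelihood a (V x) y * likelihood a (V x') y / totalLikelihood S V a y)) ∂(stdGaussian F)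
  have h5 := mul_le_mul_of_nonneg_left hle (inv_nonneg.2 (mul_pos hδ hM).le)
  have h6 : (S.card : ℝ) ≤ E + (ε * S.card + 2 * (S.card * Real.exp (-(τ ^ 2 / 2))) +
      δ * S.card + (δ * S.card)⁻¹ * ∑ x ∈ S, ∑ x' ∈ S, B x x') := by linarith
  have h7 := mul_le_mul_of_nonneg_left h6 (inv_nonneg.2 hM.le)
  have h8 : (S.card : ℝ)⁻¹ * (E + (ε * S.card + 2 * (S.card * Real.exp (-(τ ^ 2 / 2))) +
      δ * S.card + (δ * S.card)⁻¹ * ∑ x ∈ S, ∑ x' ∈ S, B x x')) =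
      (S.card : ℝ)⁻¹ * E + (ε + 2 * Real.exp (-(τ ^ 2 / 2)) + δ +
      δ⁻¹ * ((S.card : ℝ)⁻¹ ^ 2 * ∑ x ∈ S, ∑ x' ∈ S, B x x')) := by
    field_simp
  rw [h8, inv_mul_cancel₀ hM.ne'] at h7
  linarith

theorem posteriorError_le {S : Finset α} (hS : S.Nonempty) {V : α → F}
    (hV : ∀ x ∈ S, ‖V x‖ = 1) {a τ ε : ℝ} (ha : 0 ≤ a) (hτ : 0 ≤ τ) (hε : 0 ≤ ε)
    {B : α → α → ℝ} (hB0 : ∀ x ∈ S, ∀ x' ∈ S, 0 ≤ B x x')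
    (hB : ∀ x ∈ S, ∀ x' ∈ S, ⟪V x, V x'⟫ ≤ 1 - ε →
      Real.exp (-(a ^ 2 / 2 - τ * a) *
        ((1 - max ⟪V x, V x'⟫ 0) / (1 + max ⟪V x, V x'⟫ 0))) ≤ B x x') :
    posteriorError S V a ≤ ε + 4 * Real.exp (-(τ ^ 2 / 2)) +
      2 * ((S.card : ℝ)⁻¹ * ∑ x ∈ S, ∑ x' ∈ S, B x x') := by
  have hM : (0 : ℝ) < S.card := by exact_mod_cast hS.card_pos
  obtain ⟨hi, hle⟩ := integral_sum_ite_le (S := S) (B := B)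
    (p := fun x x' => ⟪V x, V x'⟫ ≤ 1 - ε) (f := fun x x' => lowerPairBound a τ (V x) (V x'))
    (fun x x' => integrable_exp_smul_inner_add _ _ _) hB0 fun x hx x' hx' h =>
      (integral_lowerPairBound_le a τ (hV x hx) (hV x' hx')).trans (hB x hx x' hx' h)
  have hiT := integrable_totalLikelihood S V a
  have hit : Integrable (fun y => ∑ x ∈ S, tiltedLikelihood a (-τ) (V x) y) (stdGaussian F) :=
    integrable_finsetSum _ fun x _ => integrable_tiltedLikelihood a (-τ) (V x)
  have hmono := integral_mono (integrable_sum_one_sub_inner hS V a)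
    (((hiT.const_mul ε).add (hit.const_mul 4)).add (hi.const_mul 2))
    (sum_one_sub_inner_upper_bound hS hV ha hτ hε)
  rw [integral_add' ((hiT.const_mul ε).add (hit.const_mul 4)) (hi.const_mul 2),
    integral_add' (hiT.const_mul ε) (hit.const_mul 4), integral_const_mul, integral_const_mul,
    integral_const_mul, integral_totalLikelihood hV, integral_sum_tiltedLikelihood hV,
    neg_sq] at hmono
  rw [posteriorError, integral_const_mul]
  refine (mul_le_mul_of_nonneg_left (hmono.trans (add_le_add_right
    (mul_le_mul_of_nonneg_left hle zero_le_two) _)) (inv_nonneg.2 hM.le)).trans (le_of_eq ?_)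
  field_simp

end Bounds

/-! ### Intersections of random `k`-subsets -/

section Combinatorics

/-- Each removed element costs a factor `k/p`, and `k/p` only decreases when both are lowered by
one. -/
theorem choose_sub_le_choose_mul_pow {p k c : ℕ} (hk : k ≤ p) (hc : c ≤ k) :
    (((p - c).choose (k - c) : ℕ) : ℝ) ≤ p.choose k * ((k : ℝ) / p) ^ c := by
  induction c generalizing p k with
  | zero => simp
  | succ c ih =>
    obtain ⟨k, rfl⟩ : ∃ k', k = k' + 1 := ⟨k - 1, by omega⟩
    obtain ⟨p, rfl⟩ : ∃ p', p = p' + 1 := ⟨p - 1, by omega⟩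
    have hkp : (k : ℝ) ≤ p := by exact_mod_cast Nat.le_of_succ_le_succ hk
    have h1 := ih (Nat.le_of_succ_le_succ hk) (Nat.le_of_succ_le_succ hc)
    have h2 : (k : ℝ) / p ≤ ((k + 1 : ℕ) : ℝ) / ((p + 1 : ℕ) : ℝ) := by
      rcases p.eq_zero_or_pos with rfl | hp
      · simp; positivity
      · rw [div_le_div_iff₀ (by exact_mod_cast hp) (by positivity)]
        push_cast; nlinarith
    have h3 : ((p.choose k : ℕ) : ℝ) =
        ((p + 1).choose (k + 1) : ℕ) * (((k + 1 : ℕ) : ℝ) / ((p + 1 : ℕ) : ℝ)) := by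
      have : (((p + 1) * p.choose k : ℕ) : ℝ) = ((p + 1).choose (k + 1) * (k + 1) : ℕ) := by
        exact_mod_cast Nat.add_one_mul_choose_eq p k
      push_cast at this ⊢
      field_simp
      linarith
    rw [Nat.add_sub_add_right, Nat.add_sub_add_right]
    refine h1.trans ?_
    rw [h3, pow_succ', ← mul_assoc]
    gcongr

variable {ι : Type*} [Fintype ι] [DecidableEq ι]

theorem card_powersetCard_filter_superset_le {k : ℕ} (C : Finset ι) :
    ((Finset.powersetCard k (Finset.univ : Finset ι)).filter (C ⊆ ·)).card ≤
      (Fintype.card ι - C.card).choose (k - C.card) := by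
  rw [← Finset.card_compl, ← Finset.card_powersetCard]
  refine Finset.card_le_card_of_injOn (· \ C) (fun B hB => ?_) (fun B hB B' hB' h => ?_)
  · simp only [Finset.coe_filter, Finset.mem_powersetCard, Set.mem_ofPred_eq] at hB
    simp only [Finset.mem_coe, Finset.mem_powersetCard]
    refine ⟨fun i hi => ?_, ?_⟩
    · simp only [Finset.mem_sdiff] at hi
      simpa using hi.2
    · rw [Finset.card_sdiff_of_subset hB.2, hB.1.2]
  · simp only [Finset.coe_filter, Finset.mem_powersetCard, Set.mem_ofPred_eq] at hB hB'
    rw [← Finset.sdiff_union_of_subset hB.2, ← Finset.sdiff_union_of_subset hB'.2]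
    exact congrArg (· ∪ C) h

/-- The summand is the term `C = A ∩ B` of a sum over `C ⊆ A` with `C ⊆ B`. A fraction at most
`(k/p)^|C|` of the sets `B` contains `C`, which cancels `(p/k)^|C|`, so each of the `2^k` subsets of
`A` contributes at most `p.choose k`. -/
theorem sum_powersetCard_pow_card_inter_le {k : ℕ} (hk : 1 ≤ k) (hkp : k ≤ Fintype.card ι)
    (A : Finset ι) (hA : A.card = k) :
    ∑ B ∈ Finset.powersetCard k (Finset.univ : Finset ι),
      ((Fintype.card ι : ℝ) / k) ^ (A ∩ B).card ≤ 2 ^ k * (Fintype.card ι).choose k := by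
  set p := Fintype.card ι
  have hk0 : (0 : ℝ) < k := by exact_mod_cast hk
  have hp0 : (0 : ℝ) < p := by exact_mod_cast hk.trans hkp
  calc ∑ B ∈ Finset.powersetCard k (Finset.univ : Finset ι), ((p : ℝ) / k) ^ (A ∩ B).card
      ≤ ∑ B ∈ Finset.powersetCard k (Finset.univ : Finset ι), ∑ C ∈ A.powerset,
          if C ⊆ B then ((p : ℝ) / k) ^ C.card else 0 := by
        refine Finset.sum_le_sum fun B _ => ?_
        have := Finset.single_le_sum (s := A.powerset)
          (f := fun C => if C ⊆ B then ((p : ℝ) / k) ^ C.card else 0)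
          (fun C _ => by split_ifs <;> positivity)
          (Finset.mem_powerset.2 (Finset.inter_subset_left (s₁ := A) (s₂ := B)))
        simpa [Finset.inter_subset_right] using this
    _ = ∑ C ∈ A.powerset,
          ((Finset.powersetCard k (Finset.univ : Finset ι)).filter (C ⊆ ·)).card *
            ((p : ℝ) / k) ^ C.card := by
        rw [Finset.sum_comm]
        refine Finset.sum_congr rfl fun C _ => ?_
        rw [← Finset.sum_filter, Finset.sum_const, nsmul_eq_mul]
    _ ≤ ∑ C ∈ A.powerset, (p.choose k : ℝ) := by
        refine Finset.sum_le_sum fun C hC => ?_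
        have hCk : C.card ≤ k := hA ▸ Finset.card_le_card (Finset.mem_powerset.1 hC)
        have h1 : (((Finset.powersetCard k (Finset.univ : Finset ι)).filter (C ⊆ ·)).card : ℝ) ≤
            p.choose k * ((k : ℝ) / p) ^ C.card :=
          (Nat.cast_le.2 (card_powersetCard_filter_superset_le C)).trans
            (choose_sub_le_choose_mul_pow hkp hCk)
        refine (mul_le_mul_of_nonneg_right h1 (by positivity)).trans (le_of_eq ?_)
        rw [mul_assoc, ← mul_pow, div_mul_div_cancel₀ hp0.ne', div_self hk0.ne', one_pow, mul_one]
    _ = _ := by rw [Finset.sum_const, Finset.card_powerset, hA, nsmul_eq_mul]; push_cast; rfl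

/-- Combine `p.choose k ≤ p^k/k!` with `k^k/k! ≤ e^k`. -/
theorem choose_le_exp {p k : ℕ} (hk : 1 ≤ k) (hkp : k ≤ p) :
    (p.choose k : ℝ) ≤ Real.exp (k * Real.log (p / k) + k) := by
  have hk0 : (0 : ℝ) < k := by exact_mod_cast hk
  have hp0 : (0 : ℝ) < p := by exact_mod_cast hk.trans hkp
  have h1 : (p.choose k : ℝ) ≤ (p : ℝ) ^ k / (k.factorial : ℝ) := Nat.choose_le_pow_div k p
  have h2 : (k : ℝ) ^ k / (k.factorial : ℝ) ≤ Real.exp k :=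
    Real.pow_div_factorial_le_exp _ hk0.le k
  rw [Real.exp_add, ← Real.log_pow, Real.exp_log (by positivity), div_pow]
  refine h1.trans ?_
  calc (p : ℝ) ^ k / (k.factorial : ℝ) = p ^ k / k ^ k * (k ^ k / (k.factorial : ℝ)) := by
        field_simp
    _ ≤ _ := by gcongr

end Combinatorics

/-! ### Sparse vectors, their overlaps and the two priors -/

noncomputable section SparseVectors

open scoped RealInnerProductSpace

variable {p k : ℕ}

/-- The positions of the nonzero entries. -/
def nonzeroPositions (x : EuclideanSpace ℝ (Fin p)) : Finset (Fin p) :=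
  Finset.univ.filter fun i => x i ≠ 0

/-- A finite set of unit vectors with exactly `k` nonzero entries of equal absolute value, over
which the support is equidistributed enough. -/
structure IsSparseFamily (k : ℕ) (S : Finset (EuclideanSpace ℝ (Fin p))) : Prop where
  nonempty : S.Nonempty
  apply_eq : ∀ x ∈ S, ∀ i, x i = 0 ∨ |x i| = 1 / √(k : ℝ)
  card_nonzeroPositions : ∀ x ∈ S, (nonzeroPositions x).card = k
  sum_pow_le : ∀ A : Finset (Fin p), A.card = k →
    ∑ x ∈ S, ((p : ℝ) / k) ^ (A ∩ nonzeroPositions x).card ≤ 2 ^ k * S.card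
  card_le : (S.card : ℝ) ≤ 2 ^ k * p.choose k

/-- The fraction of common nonzero positions of two `k`-sparse vectors. -/
def overlap (k : ℕ) (x x' : EuclideanSpace ℝ (Fin p)) : ℝ :=
  ((nonzeroPositions x ∩ nonzeroPositions x').card : ℝ) / k

theorem overlap_nonneg (x x' : EuclideanSpace ℝ (Fin p)) : 0 ≤ overlap k x x' := by
  unfold overlap; positivity

theorem overlap_le_one {x : EuclideanSpace ℝ (Fin p)} (hx : (nonzeroPositions x).card = k)
    (x' : EuclideanSpace ℝ (Fin p)) : overlap k x x' ≤ 1 := by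
  refine div_le_one_of_le₀ ?_ (by positivity)
  rw [← hx]
  exact_mod_cast Finset.card_le_card Finset.inter_subset_left

theorem IsSparseFamily.norm_eq_one {S : Finset (EuclideanSpace ℝ (Fin p))}
    (h : IsSparseFamily k S) (hk : 1 ≤ k) {x : EuclideanSpace ℝ (Fin p)} (hx : x ∈ S) :
    ‖x‖ = 1 := by
  have hk0 : (0 : ℝ) < k := by exact_mod_cast hk
  have hsum : ∑ i, x i ^ 2 = ∑ i ∈ nonzeroPositions x, (1 / k : ℝ) := by
    rw [nonzeroPositions, Finset.sum_filter]
    refine Finset.sum_congr rfl fun i _ => ?_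
    rcases eq_or_ne (x i) 0 with h0 | h0
    · simp [h0]
    · rw [if_pos h0, ← sq_abs, (h.apply_eq x hx i).resolve_left h0, div_pow, one_pow,
        Real.sq_sqrt hk0.le]
  rw [EuclideanSpace.norm_eq]
  simp only [Real.norm_eq_abs, sq_abs]
  rw [hsum, Finset.sum_const, h.card_nonzeroPositions x hx, nsmul_eq_mul,
    mul_one_div_cancel hk0.ne', Real.sqrt_one]

theorem IsSparseFamily.abs_inner_le_overlap {S : Finset (EuclideanSpace ℝ (Fin p))}
    (h : IsSparseFamily k S) {x x' : EuclideanSpace ℝ (Fin p)} (hx : x ∈ S) (hx' : x' ∈ S) :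
    |⟪x, x'⟫| ≤ overlap k x x' := by
  have hterm (i : Fin p) : |x' i * x i| ≤
      if i ∈ nonzeroPositions x ∩ nonzeroPositions x' then (1 / k : ℝ) else 0 := by
    simp only [nonzeroPositions, Finset.mem_inter, Finset.mem_filter, Finset.mem_univ, true_and]
    by_cases h1 : x i = 0
    · simp [h1]
    by_cases h2 : x' i = 0
    · simp [h2]
    rw [if_pos ⟨h1, h2⟩, abs_mul, (h.apply_eq x hx i).resolve_left h1,
      (h.apply_eq x' hx' i).resolve_left h2, div_mul_div_comm, one_mul,
      Real.mul_self_sqrt (by positivity)]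
  rw [PiLp.inner_apply]
  simp only [RCLike.inner_apply, conj_trivial]
  refine (Finset.abs_sum_le_sum_abs _ _).trans ((Finset.sum_le_sum fun i _ => hterm i).trans ?_)
  rw [← Finset.sum_filter, Finset.sum_const, nsmul_eq_mul, mul_one_div, overlap,
    Finset.filter_mem_eq_inter, Finset.univ_inter]

theorem inner_tensorPow (d : ℕ) (x x' : EuclideanSpace ℝ (Fin p)) :
    ⟪tensorPow d x, tensorPow d x'⟫ = ⟪x, x'⟫ ^ d := by
  simp only [PiLp.inner_apply, tensorPow, RCLike.inner_apply, conj_trivial]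
  rw [Fintype.sum_pow]
  simp only [Finset.prod_mul_distrib]

theorem norm_tensorPow (d : ℕ) {x : EuclideanSpace ℝ (Fin p)} (hx : ‖x‖ = 1) :
    ‖tensorPow d x‖ = 1 := by
  have h := inner_tensorPow d x x
  rw [real_inner_self_eq_norm_sq, real_inner_self_eq_norm_sq, hx, one_pow, one_pow] at h
  exact (pow_eq_one_iff_of_nonneg (norm_nonneg _) two_ne_zero).1 h

theorem measurable_tensorPow (d : ℕ) :
    Measurable (tensorPow d : EuclideanSpace ℝ (Fin p) → _) := by
  have : Continuous (tensorPow d : EuclideanSpace ℝ (Fin p) → _) := by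
    unfold tensorPow; fun_prop
  exact this.measurable

/-- The vector with nonzero positions `B`, equal to `-1/√k` on `N` and to `1/√k` on `B \ N`. -/
def signedIndicator (k : ℕ) (b : (_ : Finset (Fin p)) × Finset (Fin p)) :
    EuclideanSpace ℝ (Fin p) :=
  WithLp.toLp 2 fun i => if i ∈ b.2 then -(1 / √(k : ℝ)) else if i ∈ b.1 then 1 / √(k : ℝ) else 0

theorem nonzeroPositions_signedIndicator (hk : 1 ≤ k)
    {b : (_ : Finset (Fin p)) × Finset (Fin p)} (hb : b.2 ⊆ b.1) :
    nonzeroPositions (signedIndicator k b) = b.1 := by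
  have hk0 : (0 : ℝ) < 1 / √(k : ℝ) := by
    have : (0 : ℝ) < k := by exact_mod_cast hk
    positivity
  ext i
  simp only [nonzeroPositions, signedIndicator, Finset.mem_filter, Finset.mem_univ, true_and]
  split_ifs with h1 h2
  · simp [hb h1]
    omega
  · simp [h2]
    omega
  · simp [h2]

theorem signedIndicator_apply_neg_iff (hk : 1 ≤ k)
    (b : (_ : Finset (Fin p)) × Finset (Fin p)) (i : Fin p) :
    signedIndicator k b i < 0 ↔ i ∈ b.2 := by
  have hk0 : (0 : ℝ) < 1 / √(k : ℝ) := by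
    have : (0 : ℝ) < k := by exact_mod_cast hk
    positivity
  simp only [signedIndicator]
  split_ifs with h1 h2
  · simpa [h1] using Nat.lt_of_succ_le hk
  · simp only [h1, iff_false, not_lt]; exact hk0.le
  · simp [h1]

/-- Every support carries the same number `m` of sign patterns, so averages over the family of
functions of the support are averages over `k`-subsets. Bernoulli has `m = 1`, Bernoulli-Rademacher
`m = 2^k`. -/
theorem isSparseFamily_image_signedIndicator (hk : 1 ≤ k) (hkp : k ≤ p) {m : ℕ} (hm : 1 ≤ m)
    (hmk : m ≤ 2 ^ k) (N : Finset (Fin p) → Finset (Finset (Fin p)))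
    (hN : ∀ B, ∀ C ∈ N B, C ⊆ B) (hNm : ∀ B, B.card = k → (N B).card = m) :
    IsSparseFamily k (((Finset.powersetCard k Finset.univ).sigma N).image (signedIndicator k)) := by
  have hinj : Set.InjOn (signedIndicator k)
      (((Finset.powersetCard k Finset.univ).sigma N : Finset _) :
        Set ((_ : Finset (Fin p)) × Finset (Fin p))) := by
    rintro ⟨B, C⟩ hb ⟨B', C'⟩ hb' h
    simp only [Finset.mem_coe, Finset.mem_sigma] at hb hb'
    have h1 := nonzeroPositions_signedIndicator hk (b := ⟨B, C⟩) (hN _ _ hb.2)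
    have h2 := nonzeroPositions_signedIndicator hk (b := ⟨B', C'⟩) (hN _ _ hb'.2)
    have h3 : B = B' := by rw [h, h2] at h1; exact h1.symm
    have h4 : C = C' := by
      ext i
      have h5 := signedIndicator_apply_neg_iff hk ⟨B, C⟩ i
      rw [h, signedIndicator_apply_neg_iff hk] at h5
      exact h5.symm
    rw [h3, h4]
  have hsum (f : Finset (Fin p) → ℝ) :
      ∑ x ∈ ((Finset.powersetCard k Finset.univ).sigma N).image (signedIndicator k),
        f (nonzeroPositions x) = m * ∑ B ∈ Finset.powersetCard k Finset.univ, f B := by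
    rw [Finset.sum_image hinj, Finset.sum_sigma, Finset.mul_sum]
    refine Finset.sum_congr rfl fun B hB => ?_
    rw [← hNm B (Finset.mem_powersetCard.1 hB).2, ← nsmul_eq_mul, ← Finset.sum_const]
    exact Finset.sum_congr rfl fun C hC => by
      rw [nonzeroPositions_signedIndicator hk (hN B C hC)]
  have hcard : ((((Finset.powersetCard k Finset.univ).sigma N).image
      (signedIndicator k)).card : ℝ) = m * p.choose k := by
    have := hsum fun _ => 1
    simpa using this
  have hsupp : ∀ x ∈ ((Finset.powersetCard k Finset.univ).sigma N).image (signedIndicator k),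
      (nonzeroPositions x).card = k := by
    intro x hx
    obtain ⟨b, hb, rfl⟩ := Finset.mem_image.1 hx
    rw [Finset.mem_sigma] at hb
    rw [nonzeroPositions_signedIndicator hk (hN _ _ hb.2)]
    exact (Finset.mem_powersetCard.1 hb.1).2
  refine ⟨?_, ?_, hsupp, ?_, ?_⟩
  · rw [← Finset.card_pos]
    have h1 : 0 < m * p.choose k := Nat.mul_pos hm (Nat.choose_pos hkp)
    exact_mod_cast hcard ▸ (by exact_mod_cast h1 : (0 : ℝ) < m * p.choose k)
  · intro x hx i
    obtain ⟨b, -, rfl⟩ := Finset.mem_image.1 hx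
    simp only [signedIndicator]
    split_ifs <;> simp
  · intro A hA
    rw [hsum fun B => ((p : ℝ) / k) ^ (A ∩ B).card, hcard, mul_left_comm]
    have := sum_powersetCard_pow_card_inter_le hk (by simpa using hkp) A hA
    rw [Fintype.card_fin] at this
    gcongr
  · rw [hcard]
    gcongr
    exact_mod_cast hmk

theorem exists_isSparseFamily_eq_bernoulliSupport (hk : 1 ≤ k) (hkp : k ≤ p) :
    ∃ S : Finset (EuclideanSpace ℝ (Fin p)),
      (S : Set (EuclideanSpace ℝ (Fin p))) = bernoulliSupport p k ∧ IsSparseFamily k S := by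
  refine ⟨_, ?_, isSparseFamily_image_signedIndicator hk hkp le_rfl Nat.one_le_two_pow
    (fun _ => {∅}) (by simp) (by simp)⟩
  have hk0 : (0 : ℝ) < 1 / √(k : ℝ) := by
    have : (0 : ℝ) < k := by exact_mod_cast hk
    positivity
  ext x
  simp only [Finset.coe_image, Set.mem_image, Finset.mem_coe, Finset.mem_sigma,
    Finset.mem_powersetCard, Finset.mem_singleton, bernoulliSupport, Set.mem_ofPred_eq]
  have hncard : {i | x i ≠ 0}.ncard = (nonzeroPositions x).card := by
    rw [← Set.ncard_coe_finset]; simp [nonzeroPositions]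
  constructor
  · rintro ⟨⟨B, C⟩, ⟨⟨-, hB⟩, rfl : C = ∅⟩, rfl⟩
    refine ⟨fun i => ?_, ?_⟩
    · simp only [signedIndicator, Finset.notMem_empty, if_false]
      split_ifs <;> simp
    · rw [hncard, nonzeroPositions_signedIndicator hk (by simp), hB]
  · rintro ⟨h1, h2⟩
    refine ⟨⟨nonzeroPositions x, ∅⟩, ⟨⟨Finset.subset_univ _, hncard ▸ h2⟩, rfl⟩, ?_⟩
    ext i
    simp only [signedIndicator, nonzeroPositions, Finset.notMem_empty, if_false,
      Finset.mem_filter, Finset.mem_univ, true_and]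
    rcases h1 i with h | h
    · simp [h]
    · rw [if_pos (h ▸ hk0.ne'), h]

theorem exists_isSparseFamily_eq_bernoulliRademacherSupport (hk : 1 ≤ k) (hkp : k ≤ p) :
    ∃ S : Finset (EuclideanSpace ℝ (Fin p)),
      (S : Set (EuclideanSpace ℝ (Fin p))) = bernoulliRademacherSupport p k ∧
        IsSparseFamily k S := by
  refine ⟨_, ?_, isSparseFamily_image_signedIndicator hk hkp Nat.one_le_two_pow le_rfl
    (fun B => B.powerset) (by simp) (fun B hB => by rw [Finset.card_powerset, hB])⟩
  have hk0 : (0 : ℝ) < 1 / √(k : ℝ) := by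
    have : (0 : ℝ) < k := by exact_mod_cast hk
    positivity
  ext x
  simp only [Finset.coe_image, Set.mem_image, Finset.mem_coe, Finset.mem_sigma,
    Finset.mem_powersetCard, Finset.mem_powerset, bernoulliRademacherSupport, Set.mem_ofPred_eq]
  have hncard : {i | x i ≠ 0}.ncard = (nonzeroPositions x).card := by
    rw [← Set.ncard_coe_finset]; simp [nonzeroPositions]
  constructor
  · rintro ⟨⟨B, C⟩, ⟨⟨-, hB⟩, hC⟩, rfl⟩
    refine ⟨fun i => ?_, ?_⟩
    · simp only [signedIndicator]
      split_ifs <;> simp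
    · rw [hncard, nonzeroPositions_signedIndicator hk hC, hB]
  · rintro ⟨h1, h2⟩
    refine ⟨⟨nonzeroPositions x, Finset.univ.filter fun i => x i < 0⟩,
      ⟨⟨Finset.subset_univ _, hncard ▸ h2⟩, fun i hi => ?_⟩, ?_⟩
    · simp only [Finset.mem_filter, Finset.mem_univ, true_and] at hi
      simpa [nonzeroPositions] using hi.ne
    ext i
    simp only [signedIndicator, nonzeroPositions, Finset.mem_filter, Finset.mem_univ, true_and]
    rcases h1 i with h | h | h
    · rw [if_pos (h ▸ neg_lt_zero.2 hk0), h]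
    · simp [h]
    · rw [if_neg (h ▸ hk0.le.not_gt), if_pos (h ▸ hk0.ne'), h]

end SparseVectors

/-! ### The two regimes and the limits -/

section Asymptotics

open scoped RealInnerProductSpace

variable {p k : ℕ}

theorem tensorMMSE_eq_posteriorError (d : ℕ) (a : ℝ) (hk : 1 ≤ k)
    {S : Finset (EuclideanSpace ℝ (Fin p))} (hS : IsSparseFamily k S) :
    tensorMMSE d a (uniformOn (S : Set (EuclideanSpace ℝ (Fin p)))) =
      posteriorError S (tensorPow d) a :=
  integral_norm_sub_condExp_sq hS.nonempty (measurable_tensorPow d)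
    (fun _ hx => norm_tensorPow d (hS.norm_eq_one hk hx)) a

theorem IsSparseFamily.sum_exp_overlap_le {S : Finset (EuclideanSpace ℝ (Fin p))}
    (hS : IsSparseFamily k S) (hk : 1 ≤ k) (hkp : k ≤ p) :
    ∑ x ∈ S, ∑ x' ∈ S, Real.exp (k * Real.log (p / k) * overlap k x x') ≤
      2 ^ k * (S.card : ℝ) ^ 2 := by
  have hk0 : (0 : ℝ) < k := by exact_mod_cast hk
  have hp0 : (0 : ℝ) < p := by exact_mod_cast hk.trans hkp
  have h1 : ∀ x ∈ S, ∑ x' ∈ S, Real.exp (k * Real.log (p / k) * overlap k x x') ≤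
      2 ^ k * (S.card : ℝ) := by
    intro x hx
    refine le_trans (le_of_eq (Finset.sum_congr rfl fun x' _ => ?_))
      (hS.sum_pow_le _ (hS.card_nonzeroPositions x hx))
    rw [overlap, mul_right_comm, mul_div_cancel₀ _ hk0.ne', Real.exp_nat_mul,
      Real.exp_log (by positivity)]
  refine (Finset.sum_le_sum h1).trans (le_of_eq ?_)
  rw [Finset.sum_const, nsmul_eq_mul]; ring

theorem IsSparseFamily.inner_tensorPow_le {S : Finset (EuclideanSpace ℝ (Fin p))}
    (hS : IsSparseFamily k S) {d : ℕ} (hd : 2 ≤ d) {x x' : EuclideanSpace ℝ (Fin p)}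
    (hx : x ∈ S) (hx' : x' ∈ S) : ⟪tensorPow d x, tensorPow d x'⟫ ≤ overlap k x x' ^ 2 := by
  rw [inner_tensorPow]
  calc ⟪x, x'⟫ ^ d ≤ |⟪x, x'⟫| ^ d := by rw [← abs_pow]; exact le_abs_self _
    _ ≤ overlap k x x' ^ d := by gcongr; exact hS.abs_inner_le_overlap hx hx'
    _ ≤ overlap k x x' ^ 2 := pow_le_pow_of_le_one (overlap_nonneg _ _)
        (overlap_le_one (hS.card_nonzeroPositions x hx) _) hd

theorem one_sub_posteriorError_tensorPow_le {S : Finset (EuclideanSpace ℝ (Fin p))}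
    (hS : IsSparseFamily k S) (hk : 1 ≤ k) (hkp : k ≤ p) {d : ℕ} (hd : 2 ≤ d)
    {β η c ε δ : ℝ} (hβ : 0 ≤ β) (hη : 0 ≤ η) (hc : 0 ≤ c) (hβc : β ^ 2 + 2 * η * β ≤ 1 - c)
    (hε : 0 ≤ ε) (hδ : 0 < δ) :
    1 - posteriorError S (tensorPow d) (sparseAmplitude p k β) ≤
      ε + 2 * Real.exp (-(η ^ 2 * (k * Real.log (p / k)))) + δ +
        δ⁻¹ * Real.exp (k - c * ε * (k * Real.log (p / k))) := by
  have hk0 : (0 : ℝ) < k := by exact_mod_cast hk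
  have hM : (0 : ℝ) < S.card := by exact_mod_cast hS.nonempty.card_pos
  have hh : 0 ≤ k * Real.log ((p : ℝ) / k) :=
    mul_nonneg hk0.le (Real.log_nonneg ((one_le_div hk0).2 (by exact_mod_cast hkp)))
  have hsum := hS.sum_exp_overlap_le hk hkp
  have hamp : sparseAmplitude p k β = β * √(2 * (k * Real.log ((p : ℝ) / k))) := by
    rw [sparseAmplitude, mul_assoc]
  rw [hamp]
  set h := k * Real.log ((p : ℝ) / k)
  have hsq : √(2 * h) ^ 2 = 2 * h := Real.sq_sqrt (by positivity)
  have hV : ∀ x ∈ S, ‖tensorPow d x‖ = 1 := fun x hx => norm_tensorPow d (hS.norm_eq_one hk hx)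
  -- `τ` is scaled like `a = β√(2h)`, so that every exponent is a multiple of `h`.
  refine (one_sub_posteriorError_le (τ := η * √(2 * h)) (ε := ε) (δ := δ) hS.nonempty hV
    (by positivity) (by positivity) hε hδ
    (B := fun x x' => Real.exp (-(c * ε * h)) * Real.exp (h * overlap k x x'))
    (fun _ _ _ _ => by positivity) fun x hx x' hx' hρ => ?_).trans ?_
  · rw [← Real.exp_add]
    refine Real.exp_le_exp.2 ?_
    have hq := hS.inner_tensorPow_le hd hx hx'
    have hρ1 := inner_le_one_of_unit (hV x hx) (hV x' hx')
    have hq0 := overlap_nonneg (k := k) x x'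
    have hq1 := overlap_le_one (hS.card_nonzeroPositions x hx) x'
    set ρ := ⟪tensorPow d x, tensorPow d x'⟫
    set q := overlap k x x'
    have hρ0 : 0 ≤ ρ := hε.trans hρ
    -- As `2ρ/(1+ρ)` increases with `ρ ≤ q²`, this reduces to `2q ≤ 1 + q²`.
    have ht1 : 2 * (ρ / (1 + ρ)) ≤ q := by
      rw [← mul_div_assoc, div_le_iff₀ (by positivity)]
      nlinarith [mul_le_mul_of_nonneg_left hq (by linarith : 0 ≤ 2 - q),
        mul_nonneg hq0 (sq_nonneg (1 - q))]
    have ht2 : ε ≤ 2 * (ρ / (1 + ρ)) := by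
      rw [← mul_div_assoc, le_div_iff₀ (by positivity)]
      nlinarith
    have heq : ((β * √(2 * h)) ^ 2 + 2 * (η * √(2 * h)) * (β * √(2 * h))) * (ρ / (1 + ρ)) =
        (β ^ 2 + 2 * η * β) * (h * (2 * (ρ / (1 + ρ)))) := by
      linear_combination ((β ^ 2 + 2 * η * β) * (ρ / (1 + ρ))) * hsq
    rw [heq]
    set t := 2 * (ρ / (1 + ρ))
    have hht : 0 ≤ h * t := mul_nonneg hh (hε.trans ht2)
    -- With `t = 2ρ/(1+ρ)`, the exponent is at most `(1 - c)ht`; then `ht ≤ hq` and `cht ≥ cεh`.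
    nlinarith [mul_le_mul_of_nonneg_right hβc hht, mul_le_mul_of_nonneg_left ht1 hh,
      mul_le_mul_of_nonneg_left ht2 (mul_nonneg hc hh)]
  · have h1 : (η * √(2 * h)) ^ 2 / 2 = η ^ 2 * h := by
      rw [mul_pow, hsq]; ring
    rw [h1]
    simp only [← Finset.mul_sum]
    gcongr
    have h2 : (2 : ℝ) ^ k ≤ Real.exp k := by
      rw [← Real.exp_one_pow]
      gcongr
      linarith [Real.add_one_le_exp (1 : ℝ)]
    calc (S.card : ℝ)⁻¹ ^ 2 * (Real.exp (-(c * ε * h)) *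
          ∑ x ∈ S, ∑ x' ∈ S, Real.exp (h * overlap k x x'))
        ≤ (S.card : ℝ)⁻¹ ^ 2 * (Real.exp (-(c * ε * h)) * (2 ^ k * (S.card : ℝ) ^ 2)) := by gcongr
      _ = 2 ^ k * Real.exp (-(c * ε * h)) := by field_simp
      _ ≤ Real.exp k * Real.exp (-(c * ε * h)) := by gcongr
      _ = _ := by rw [← Real.exp_add, sub_eq_add_neg]

theorem posteriorError_tensorPow_le {S : Finset (EuclideanSpace ℝ (Fin p))}
    (hS : IsSparseFamily k S) (hk : 1 ≤ k) (hkp : k ≤ p) {d : ℕ} (hd : 2 ≤ d)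
    {β η c ε : ℝ} (hβ : 0 ≤ β) (hη : 0 ≤ η) (hc : 0 ≤ c) (hβc : 1 + c ≤ β ^ 2 - 2 * η * β)
    (hε : 0 ≤ ε) (hε1 : ε ≤ 1) :
    posteriorError S (tensorPow d) (sparseAmplitude p k β) ≤
      ε + 4 * Real.exp (-(η ^ 2 * (k * Real.log (p / k)))) +
        2 * Real.exp (3 * k - c * (ε / 2) * (k * Real.log (p / k))) := by
  have hk0 : (0 : ℝ) < k := by exact_mod_cast hk
  have hM : (0 : ℝ) < S.card := by exact_mod_cast hS.nonempty.card_pos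
  have hh : 0 ≤ k * Real.log ((p : ℝ) / k) :=
    mul_nonneg hk0.le (Real.log_nonneg ((one_le_div hk0).2 (by exact_mod_cast hkp)))
  have hsum := hS.sum_exp_overlap_le hk hkp
  have hchoose := choose_le_exp hk hkp
  have hamp : sparseAmplitude p k β = β * √(2 * (k * Real.log ((p : ℝ) / k))) := by
    rw [sparseAmplitude, mul_assoc]
  rw [hamp]
  set h := k * Real.log ((p : ℝ) / k)
  have hsq : √(2 * h) ^ 2 = 2 * h := Real.sq_sqrt (by positivity)
  have hV : ∀ x ∈ S, ‖tensorPow d x‖ = 1 := fun x hx => norm_tensorPow d (hS.norm_eq_one hk hx)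
  refine (posteriorError_le (τ := η * √(2 * h)) (ε := ε) hS.nonempty hV
    (by positivity) (by positivity) hε
    (B := fun x x' => Real.exp (-h - c * (ε / 2) * h) * Real.exp (h * overlap k x x'))
    (fun _ _ _ _ => by positivity) fun x hx x' hx' hρ => ?_).trans ?_
  · rw [← Real.exp_add]
    refine Real.exp_le_exp.2 ?_
    have hq := hS.inner_tensorPow_le hd hx hx'
    have hq0 := overlap_nonneg (k := k) x x'
    have hq1 := overlap_le_one (hS.card_nonzeroPositions x hx) x'
    set ρ := ⟪tensorPow d x, tensorPow d x'⟫
    set q := overlap k x x'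
    have hr0 : 0 ≤ max ρ 0 := le_max_right _ _
    have hrq : max ρ 0 ≤ q ^ 2 := max_le hq (sq_nonneg _)
    have hr1 : max ρ 0 ≤ 1 - ε := max_le hρ (by linarith)
    set r := max ρ 0
    -- `r ≤ q²` gives `(1-r)/(1+r) ≥ 1 - 2q²/(1+q²) ≥ 1 - q`.
    have ht1 : 1 - q ≤ (1 - r) / (1 + r) := by
      rw [le_div_iff₀ (by positivity)]
      nlinarith [mul_le_mul_of_nonneg_left hrq (by linarith : 0 ≤ 2 - q),
        mul_nonneg hq0 (sq_nonneg (1 - q))]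
    have ht2 : ε / 2 ≤ (1 - r) / (1 + r) := by
      rw [div_le_div_iff₀ two_pos (by positivity)]
      nlinarith
    have heq : -((β * √(2 * h)) ^ 2 / 2 - η * √(2 * h) * (β * √(2 * h))) * ((1 - r) / (1 + r)) =
        -((β ^ 2 - 2 * η * β) * (h * ((1 - r) / (1 + r)))) := by
      linear_combination (-((β ^ 2 - 2 * η * β) * ((1 - r) / (1 + r)) / 2)) * hsq
    rw [heq]
    set t := (1 - r) / (1 + r)
    have hht : 0 ≤ h * t := mul_nonneg hh (le_trans (by positivity) ht2)
    nlinarith [mul_le_mul_of_nonneg_right hβc hht, mul_le_mul_of_nonneg_left ht1 hh,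
      mul_le_mul_of_nonneg_left ht2 (mul_nonneg hc hh)]
  · have h1 : (η * √(2 * h)) ^ 2 / 2 = η ^ 2 * h := by
      rw [mul_pow, hsq]; ring
    rw [h1]
    simp only [← Finset.mul_sum]
    gcongr
    have h2 : (2 : ℝ) ^ k ≤ Real.exp k := by
      rw [← Real.exp_one_pow]
      gcongr
      linarith [Real.add_one_le_exp (1 : ℝ)]
    calc (S.card : ℝ)⁻¹ * (Real.exp (-h - c * (ε / 2) * h) *
          ∑ x ∈ S, ∑ x' ∈ S, Real.exp (h * overlap k x x'))
        ≤ (S.card : ℝ)⁻¹ * (Real.exp (-h - c * (ε / 2) * h) * (2 ^ k * (S.card : ℝ) ^ 2)) := by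
          gcongr
      _ = 2 ^ k * S.card * Real.exp (-h - c * (ε / 2) * h) := by field_simp
      -- One `exp k` comes from the overlap average, one from the signs and one from
      -- `choose_le_exp`; the factor `exp h` in the cardinality cancels `exp(-h)`.
      _ ≤ Real.exp k * (Real.exp k * Real.exp (h + k)) * Real.exp (-h - c * (ε / 2) * h) := by
          gcongr
          exact hS.card_le.trans (by gcongr)
      _ = _ := by
          rw [← Real.exp_add, ← Real.exp_add, ← Real.exp_add]
          congr 1; ring

/-- `k = o(p)` means that `log(p/k)` eventually exceeds any constant. -/
theorem eventually_mul_le_mul_log {k : ℕ → ℕ} (hk_pos : ∀ᶠ p in atTop, 1 ≤ k p)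
    (hk : (fun p : ℕ => (k p : ℝ)) =o[atTop] fun p : ℕ => (p : ℝ)) (C : ℝ) :
    ∀ᶠ p : ℕ in atTop, C * k p ≤ k p * Real.log (p / k p) := by
  filter_upwards [hk_pos, hk.def (Real.exp_pos (-C)), eventually_gt_atTop 0] with p h1 h2 hp
  have hk0 : (0 : ℝ) < k p := by exact_mod_cast h1
  have hp0 : (0 : ℝ) < p := by exact_mod_cast hp
  rw [Real.norm_of_nonneg hk0.le, Real.norm_of_nonneg hp0.le, Real.exp_neg, ← div_eq_inv_mul,
    le_div_iff₀ (Real.exp_pos _)] at h2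
  rw [mul_comm]
  gcongr
  rw [Real.le_log_iff_exp_le (by positivity), le_div_iff₀ hk0]
  linarith

theorem tendsto_mul_log_atTop {k : ℕ → ℕ} (hk_pos : ∀ᶠ p in atTop, 1 ≤ k p)
    (hk : (fun p : ℕ => (k p : ℝ)) =o[atTop] fun p : ℕ => (p : ℝ)) :
    Tendsto (fun p : ℕ => k p * Real.log (p / k p)) atTop atTop := by
  refine tendsto_atTop.2 fun C => ?_
  filter_upwards [hk_pos, eventually_mul_le_mul_log hk_pos hk (max C 0)] with p h1 h2
  have hk0 : (1 : ℝ) ≤ k p := by exact_mod_cast h1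
  nlinarith [le_max_left C 0, le_max_right C 0]

theorem tendsto_exp_mul_sub_mul_log {k : ℕ → ℕ} (hk_pos : ∀ᶠ p in atTop, 1 ≤ k p)
    (hk : (fun p : ℕ => (k p : ℝ)) =o[atTop] fun p : ℕ => (p : ℝ)) (A : ℝ) {c : ℝ} (hc : 0 < c) :
    Tendsto (fun p : ℕ => Real.exp (A * k p - c * (k p * Real.log (p / k p)))) atTop (𝓝 0) := by
  refine Real.tendsto_exp_atBot.comp (tendsto_atBot_mono' _ ?_
    ((tendsto_mul_log_atTop hk_pos hk).const_mul_atTop_of_neg (by linarith : -(c / 2) < 0)))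
  filter_upwards [eventually_mul_le_mul_log hk_pos hk (2 * A / c)] with p hp
  have : A * k p ≤ c / 2 * (k p * Real.log (p / k p)) := by
    calc A * k p = c / 2 * (2 * A / c * k p) := by field_simp
      _ ≤ _ := by gcongr
  linarith

theorem eventually_le_self_of_isLittleO {k : ℕ → ℕ}
    (hk : (fun p : ℕ => (k p : ℝ)) =o[atTop] fun p : ℕ => (p : ℝ)) :
    ∀ᶠ p : ℕ in atTop, k p ≤ p := by
  filter_upwards [hk.def one_pos] with p h
  simpa using h

variable {k : ℕ → ℕ} {P : (p : ℕ) → Measure (EuclideanSpace ℝ (Fin p))}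

theorem tendsto_tensorMMSE_one {d : ℕ} (hd : 2 ≤ d) (hk_pos : ∀ᶠ p in atTop, 1 ≤ k p)
    (hk : (fun p : ℕ => (k p : ℝ)) =o[atTop] fun p : ℕ => (p : ℝ))
    (hP : ∀ p, 1 ≤ k p → k p ≤ p → ∃ S : Finset (EuclideanSpace ℝ (Fin p)),
      P p = uniformOn (S : Set (EuclideanSpace ℝ (Fin p))) ∧ IsSparseFamily (k p) S)
    {β : ℝ} (hβ : 0 ≤ β) (hβ1 : β < 1) :
    Tendsto (fun p : ℕ => tensorMMSE d (sparseAmplitude p (k p) β) (P p)) atTop (𝓝 1) := by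
  -- Half of the gap `1 - β²` is left as `c`; the other half pays for `2ηβ`, as `β < 1`.
  have hc : 0 < (1 - β ^ 2) / 2 := by nlinarith
  have hη : 0 < (1 - β ^ 2) / 4 := by linarith
  have hβc : β ^ 2 + 2 * ((1 - β ^ 2) / 4) * β ≤ 1 - (1 - β ^ 2) / 2 := by nlinarith
  set c := (1 - β ^ 2) / 2
  set η := (1 - β ^ 2) / 4
  refine Metric.tendsto_nhds.2 fun e he => ?_
  have h1 := (tendsto_exp_mul_sub_mul_log hk_pos hk 0 (pow_pos hη 2)).eventually
    (gt_mem_nhds (by positivity : 0 < e / 8))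
  have h2 := (tendsto_exp_mul_sub_mul_log hk_pos hk 1 (by positivity : 0 < c * (e / 4))).eventually
    (gt_mem_nhds (by positivity : 0 < e / 4 * (e / 4)))
  filter_upwards [h1, h2, hk_pos, eventually_le_self_of_isLittleO hk] with p h1 h2 hk1 hkp
  obtain ⟨S, hPS, hS⟩ := hP p hk1 hkp
  have hV : ∀ x ∈ S, ‖tensorPow d x‖ = 1 := fun x hx => norm_tensorPow d (hS.norm_eq_one hk1 hx)
  have hle := posteriorError_le_one hS.nonempty hV (sparseAmplitude p (k p) β)
  have hge := one_sub_posteriorError_tensorPow_le hS hk1 hkp hd hβ hη.le hc.le hβc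
    (by positivity : 0 ≤ e / 4) (by positivity : 0 < e / 4)
  rw [hPS, tensorMMSE_eq_posteriorError d _ hk1 hS, Real.dist_eq, abs_lt]
  rw [zero_mul, zero_sub] at h1
  rw [one_mul] at h2
  have h3 : (e / 4)⁻¹ * Real.exp (k p - c * (e / 4) * (k p * Real.log (p / k p))) < e / 4 := by
    rw [inv_mul_lt_iff₀ (by positivity)]
    exact h2
  constructor <;> linarith

theorem tendsto_tensorMMSE_zero {d : ℕ} (hd : 2 ≤ d) (hk_pos : ∀ᶠ p in atTop, 1 ≤ k p)
    (hk : (fun p : ℕ => (k p : ℝ)) =o[atTop] fun p : ℕ => (p : ℝ))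
    (hP : ∀ p, 1 ≤ k p → k p ≤ p → ∃ S : Finset (EuclideanSpace ℝ (Fin p)),
      P p = uniformOn (S : Set (EuclideanSpace ℝ (Fin p))) ∧ IsSparseFamily (k p) S)
    {β : ℝ} (hβ : 1 < β) :
    Tendsto (fun p : ℕ => tensorMMSE d (sparseAmplitude p (k p) β) (P p)) atTop (𝓝 0) := by
  have hβ0 : 0 < β := by linarith
  have hc : 0 < (β ^ 2 - 1) / 2 := by nlinarith
  have hη : 0 < (β ^ 2 - 1) / (4 * β) := div_pos (by linarith) (by positivity)
  -- `2ηβ` is exactly half of `β² - 1`; the other half is `c`.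
  have hβc : 1 + (β ^ 2 - 1) / 2 ≤ β ^ 2 - 2 * ((β ^ 2 - 1) / (4 * β)) * β := by
    refine le_of_eq ?_
    field_simp
    ring
  set c := (β ^ 2 - 1) / 2
  set η := (β ^ 2 - 1) / (4 * β)
  refine Metric.tendsto_nhds.2 fun e he => ?_
  have hε : 0 < min (e / 4) 1 := lt_min (by positivity) one_pos
  set ε := min (e / 4) 1
  have hεe : ε ≤ e / 4 := min_le_left _ _
  have h1 := (tendsto_exp_mul_sub_mul_log hk_pos hk 0 (pow_pos hη 2)).eventually
    (gt_mem_nhds (by positivity : 0 < e / 16))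
  have h2 := (tendsto_exp_mul_sub_mul_log hk_pos hk 3 (by positivity : 0 < c * (ε / 2))).eventually
    (gt_mem_nhds (by positivity : 0 < e / 8))
  filter_upwards [h1, h2, hk_pos, eventually_le_self_of_isLittleO hk] with p h1 h2 hk1 hkp
  obtain ⟨S, hPS, hS⟩ := hP p hk1 hkp
  have hV : ∀ x ∈ S, ‖tensorPow d x‖ = 1 := fun x hx => norm_tensorPow d (hS.norm_eq_one hk1 hx)
  have hge := posteriorError_nonneg hV (sparseAmplitude p (k p) β)
  have hle := posteriorError_tensorPow_le hS hk1 hkp hd hβ0.le hη.le hc.le hβc hε.le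
    (min_le_right _ _)
  rw [hPS, tensorMMSE_eq_posteriorError d _ hk1 hS, Real.dist_eq, abs_lt]
  rw [zero_mul, zero_sub] at h1
  constructor <;> linarith

end Asymptotics

theorem mainTheorem1 (d : ℕ) (hd : 2 ≤ d) (k : ℕ → ℕ)
    (hk_pos : ∀ᶠ p in atTop, 1 ≤ k p)
    (hk : (fun p : ℕ => (k p : ℝ)) =o[atTop] fun p : ℕ => (p : ℝ)) :
    (∀ β : ℝ, 0 ≤ β → β < 1 →
      Tendsto (fun p : ℕ =>
        tensorMMSE d (sparseAmplitude p (k p) β) (bernoulliPrior p (k p))) atTop (𝓝 1)) ∧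
    (∀ β : ℝ, 1 < β →
      Tendsto (fun p : ℕ =>
        tensorMMSE d (sparseAmplitude p (k p) β) (bernoulliPrior p (k p))) atTop (𝓝 0)) ∧
    (∀ β : ℝ, 0 ≤ β → β < 1 →
      Tendsto (fun p : ℕ =>
        tensorMMSE d (sparseAmplitude p (k p) β) (bernoulliRademacherPrior p (k p)))
        atTop (𝓝 1)) ∧
    (∀ β : ℝ, 1 < β →
      Tendsto (fun p : ℕ =>
        tensorMMSE d (sparseAmplitude p (k p) β) (bernoulliRademacherPrior p (k p)))
        atTop (𝓝 0)) := by
  have hB (p : ℕ) (h1 : 1 ≤ k p) (h2 : k p ≤ p) : ∃ S : Finset (EuclideanSpace ℝ (Fin p)),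
      bernoulliPrior p (k p) = uniformOn (S : Set (EuclideanSpace ℝ (Fin p))) ∧
        IsSparseFamily (k p) S := by
    obtain ⟨S, hS, hS'⟩ := exists_isSparseFamily_eq_bernoulliSupport h1 h2
    exact ⟨S, by rw [bernoulliPrior, hS], hS'⟩
  have hR (p : ℕ) (h1 : 1 ≤ k p) (h2 : k p ≤ p) : ∃ S : Finset (EuclideanSpace ℝ (Fin p)),
      bernoulliRademacherPrior p (k p) = uniformOn (S : Set (EuclideanSpace ℝ (Fin p))) ∧
        IsSparseFamily (k p) S := by
    obtain ⟨S, hS, hS'⟩ := exists_isSparseFamily_eq_bernoulliRademacherSupport h1 h2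
    exact ⟨S, by rw [bernoulliRademacherPrior, hS], hS'⟩
  exact ⟨fun β h0 h1 => tendsto_tensorMMSE_one hd hk_pos hk hB h0 h1,
    fun β h1 => tendsto_tensorMMSE_zero hd hk_pos hk hB h1,
    fun β h0 h1 => tendsto_tensorMMSE_one hd hk_pos hk hR h0 h1,
    fun β h1 => tendsto_tensorMMSE_zero hd hk_pos hk hR h1⟩
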